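/- Let $K\subset\mathbb C$ be a compact, non-polar and polynomially convex set, let $\Omega=\mathbb C\setminus K$ and $J=\partial K$, let $\omega$ be the equilibrium measure of $K$ (the Borel probability measure on $K$ that maximizes the energy $I(\nu)=\iint\log|z-w|\,d\nu(z)\,d\nu(w)$ among all Borel probability measures $\nu$ on $K$), and let $$g_\Omega(z)=\int\log|z-w|\,d\omega(w)-I(\omega)$$ be the Green's function of $\Omega$ with pole at $\infty$. Let $(q_k)_k$ be a sequence of complex polynomials of degrees $n_k>0$ with $n_k\to\infty$, and let $\mu_k=\frac1{n_k}\sum_{j=1}^{n_k}\delta_{z_{k,j}}$ be the root distribution of $q_k$, where $z_{k,1},\dots,z_{k,n_k}$ are the roots of $q_k$ repeated according to multiplicity. Suppose that $(q_k)_k$ is $K$-regular, that is, for some $R>0$ with $K\subset\mathbb D(0,R)=\{|z|<R\}$, $$\lim_{k\to\infty}\tfrac1{n_k}\log|q_k(z)|=g_\Omega(z)\quad\text{uniformly on }\mathbb C\setminus\mathbb D(0,R)$$ (with $\log 0=-\infty$). Then $\mu_k$ converges to $\omega$ in the weak-* sense if and only if $(q_k)_k$ weakly centers on $J$, that is, if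 and only if the following two conditions hold: 1. there exist $N$ and $R'>0$ such that $q_k^{-1}(\{0\})\subset\mathbb D(0,R')$ for all $k\ge N$; 2. for every closed set $L\subset\mathbb C$ with $L\cap J=\emptyset$, $\mu_k(L)\to0$ as $k\to\infty$. -/

import Mathlib

open MeasureTheory Filter Topology
open scoped ENNReal

noncomputable section

namespace KRegular

/-! ### Potential theory in the plane -/

/-- The integral of an extended-real-valued function, as the integral of the positive part minus
the integral of the negative part. -/
def eintegral {X : Type*} [MeasurableSpace X] (μ : Measure X) (f : X → EReal) : EReal :=
  ((∫⁻ x, (f x).toENNReal ∂μ : ℝ≥0∞) : EReal) - ((∫⁻ x, (-f x).toENNReal ∂μ : ℝ≥0∞) : EReal)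

/-- The logarithmic kernel `log |z - w|`, with value `-∞` on the diagonal. -/
def logKernel (z w : ℂ) : EReal := ENNReal.log ‖z - w‖ₑ

/-- The logarithmic potential `p_μ(z) = ∫ log |z - w| dμ(w)`, with values in `[-∞, ∞]`. -/
def potential (μ : Measure ℂ) (z : ℂ) : EReal := eintegral μ (fun w => logKernel z w)

/-- The logarithmic energy `I(μ) = ∬ log |z - w| dμ(z) dμ(w)`, with values in `[-∞, ∞]`. -/
def energy (μ : Measure ℂ) : EReal :=
  eintegral (μ.prod μ) (fun x => logKernel x.1 x.2)

/-- A set is polar if every nonzero finite Borel measure carried by a compact subset of it has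
energy `-∞`. -/
def IsPolar (E : Set ℂ) : Prop :=
  ∀ μ : Measure ℂ, IsFiniteMeasure μ → μ ≠ 0 → (∃ C ⊆ E, IsCompact C ∧ μ Cᶜ = 0) → energy μ = ⊥

/-- `ω` is an equilibrium measure of `K`: a Borel probability measure on `K` which has maximal
energy among all Borel probability measures on `K`. -/
def IsEquilibriumMeasure (K : Set ℂ) (ω : ProbabilityMeasure ℂ) : Prop :=
  (ω : Measure ℂ) Kᶜ = 0 ∧
    ∀ ν : ProbabilityMeasure ℂ, (ν : Measure ℂ) Kᶜ = 0 →
      energy (ν : Measure ℂ) ≤ energy (ω : Measure ℂ)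

/-- The Green's function with pole at infinity, `g_Ω(z) = p_ω(z) - I(ω)`, of the complement `Ω` of a
non-polar compact set with equilibrium measure `ω`. It is only evaluated at points of `Ω`, where
both terms are finite. -/
def greenFunction (ω : ProbabilityMeasure ℂ) (z : ℂ) : ℝ :=
  (potential (ω : Measure ℂ) z).toReal - (energy (ω : Measure ℂ)).toReal

/-! ### Polynomial convexity -/

/-- The polynomially convex hull: all `z` with `|p(z)| ≤ sup_K |p|` for every polynomial `p`. -/
def polynomialHull (K : Set ℂ) : Set ℂ :=
  {z | ∀ (p : Polynomial ℂ) (M : ℝ), (∀ w ∈ K, ‖p.eval w‖ ≤ M) → ‖p.eval z‖ ≤ M}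

/-- A set is polynomially convex if it equals its polynomially convex hull. -/
def PolynomiallyConvex (K : Set ℂ) : Prop := polynomialHull K = K

/-! ### Root distributions -/

/-- The measure `(1/n) ∑ δ_{z_j}`, where `n` is the degree of `q` and the `z_j` are the roots of
`q`, repeated with multiplicity. -/
def rootMeasure (q : Polynomial ℂ) : Measure ℂ :=
  (q.natDegree : ℝ≥0∞)⁻¹ • (q.roots.map (fun z => Measure.dirac z)).sum

theorem multiset_sum_dirac_univ (s : Multiset ℂ) :
    (s.map (fun z => (Measure.dirac z : Measure ℂ))).sum Set.univ = (Multiset.card s : ℝ≥0∞) := by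
  induction s using Multiset.induction_on with
  | empty => simp
  | cons a s ih => simp [ih, add_comm]

theorem isProbabilityMeasure_rootMeasure (q : Polynomial ℂ) (hq : 0 < q.natDegree) :
    IsProbabilityMeasure (rootMeasure q) := by
  constructor
  have hc : Multiset.card q.roots = q.natDegree :=
    IsAlgClosed.card_roots_eq_natDegree
  rw [rootMeasure, Measure.smul_apply, multiset_sum_dirac_univ, hc, smul_eq_mul]
  exact ENNReal.inv_mul_cancel (by exact_mod_cast hq.ne') (ENNReal.natCast_ne_top _)

/-- The root distribution of a non-constant polynomial, as a probability measure. -/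
def rootDistribution (q : Polynomial ℂ) (hq : 0 < q.natDegree) : ProbabilityMeasure ℂ :=
  ⟨rootMeasure q, isProbabilityMeasure_rootMeasure q hq⟩

/-! ### Sequences of polynomials -/

/-- The sequence `q` weakly centers on `C`: from some index on all roots lie in one disc, and the
proportion of the roots in any closed set disjoint from `C` tends to `0`. -/
def WeaklyCenters (q : ℕ → Polynomial ℂ) (C : Set ℂ) : Prop :=
  (∃ N : ℕ, ∃ R > 0, ∀ k ≥ N, ∀ z : ℂ, (q k).eval z = 0 → z ∈ Metric.ball (0 : ℂ) R) ∧
    ∀ L : Set ℂ, IsClosed L → Disjoint L C →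
      Tendsto (fun k => rootMeasure (q k) L) atTop (𝓝 0)

/-- `K`-regularity, where `ω` is the equilibrium measure of `K`: the functions
`(1/n_k) log |q_k|` converge to `g_Ω` uniformly on `ℂ \ 𝔻(0, R)` for some disc `𝔻(0, R)`
containing `K`. Since `log 0 = -∞` in this convergence, `q_k` has eventually no zeros there; this
is stated separately because `Real.log 0 = 0`. -/
def IsRegular (K : Set ℂ) (ω : ProbabilityMeasure ℂ) (q : ℕ → Polynomial ℂ) : Prop :=
  ∃ R > 0, K ⊆ Metric.ball (0 : ℂ) R ∧
    (∀ᶠ k in atTop, ∀ z ∈ (Metric.ball (0 : ℂ) R)ᶜ, (q k).eval z ≠ 0) ∧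
    TendstoUniformlyOn (fun k z => 1 / ((q k).natDegree : ℝ) * Real.log ‖(q k).eval z‖)
      (greenFunction ω) atTop (Metric.ball (0 : ℂ) R)ᶜ

end KRegular

end

namespace KRegular

/-! Everything is phrased with the nonnegative kernel log⁺(M/|z-w|). For measures in a disc of
radius r and M ≥ max(1, 2r) the energy is log M minus the truncated energy, so maximizing energy
becomes minimizing `truncEnergy`, and Tonelli applies without integrability conditions. At a small
scale ε the same kernel serves a second time, as a mollifier.

Two facts about the equilibrium measure carry the proof. Frostman: its truncated potential U is at
most its truncated energy e everywhere (`IsMinimizer.truncPotential_le`), while U ≥ e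
Lebesgue-almost everywhere on K (`IsMinimizer.ae_volume_le`). Mean values: the potential at z is its
mean over the circle of radius ε about z plus the potential at scale ε
(`mul_truncPotential_eq_lintegral_circleMap_add`). Together they give ω(int K) = 0, since inside K
the mean is already e and leaves no room for the second term. So ω lives on J, and weak convergence
forces centering on J by the portmanteau theorem; the common disc for the roots is part of
regularity.

Conversely, suppose the roots center on J and let μ be a limit of the root distributions along an
ultrafilter; it is carried by J. Outside a disc, (1/n) log|q| is a constant plus the potential of
the root distribution, so in the limit the potentials of μ and ω differ by a constant near infinity.
Both are log|z| + o(1), hence the constant is 0. Analytic continuation and polynomial convexity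
extend the equality to all of Ω (`logPotential_eq_of_notMem`). Thus the truncated potential of μ is
at most e near K off K, by lower semicontinuity also on J, and so μ is a minimizer too. Now both
truncated potentials equal e almost everywhere on K, hence they agree almost everywhere on a large
disc, and mollification gives μ = ω (`IsMinimizer.eq_of_logPotential_eq`). Every ultrafilter limit
being ω, the sequence converges. -/

/-- The truncated logarithmic kernel `log⁺ (M / |z - w|)`, with value `∞` on the diagonal. -/
noncomputable def kern (M : ℝ) (z w : ℂ) : ℝ≥0∞ :=
  (ENNReal.log (ENNReal.ofReal M / ‖z - w‖ₑ)).toENNReal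

/-- The potential of a measure with respect to the truncated logarithmic kernel. -/
noncomputable def truncPotential (M : ℝ) (μ : Measure ℂ) (z : ℂ) : ℝ≥0∞ := ∫⁻ w, kern M z w ∂μ

/-- The energy of a measure with respect to the truncated logarithmic kernel. -/
noncomputable def truncEnergy (M : ℝ) (μ : Measure ℂ) : ℝ≥0∞ := ∫⁻ z, truncPotential M μ z ∂μ

/-! ### The truncated kernel, its potentials and energies. -/

section Kernel

variable {M : ℝ} {z w : ℂ}

theorem kern_self (hM : 0 < M) (z : ℂ) : kern M z z = ⊤ := by
  have : ENNReal.ofReal M ≠ 0 := by simpa using hM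
  simp [kern, ENNReal.div_zero this]

theorem kern_of_ne (hM : 0 < M) (h : z ≠ w) :
    kern M z w = ENNReal.ofReal (Real.log M - Real.log ‖z - w‖) := by
  have h1 : 0 < ‖z - w‖ := norm_pos_iff.2 (sub_ne_zero.2 h)
  rw [kern, ← ofReal_norm, ← ENNReal.ofReal_div_of_pos h1,
    ENNReal.log_ofReal_of_pos (div_pos hM h1), EReal.toENNReal_of_ne_top (EReal.coe_ne_top _),
    EReal.toReal_coe, Real.log_div hM.ne' h1.ne']

theorem kern_comm (M : ℝ) (z w : ℂ) : kern M z w = kern M w z := by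
  rw [kern, kern, ← ofReal_norm, norm_sub_rev, ofReal_norm]

theorem continuous_kern (M : ℝ) : Continuous fun p : ℂ × ℂ => kern M p.1 p.2 := by
  refine (ENNReal.continuous_log.comp ?_).ereal_toENNReal
  simp_rw [div_eq_mul_inv]
  exact (ENNReal.continuous_const_mul ENNReal.ofReal_ne_top).comp
    (continuous_inv.comp (continuous_enorm.comp (continuous_fst.sub continuous_snd)))

theorem continuous_kern_left (M : ℝ) (w : ℂ) : Continuous fun z => kern M z w := by
  change Continuous ((fun p : ℂ × ℂ => kern M p.1 p.2) ∘ fun z => (z, w))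
  exact (continuous_kern M).comp (Continuous.prodMk_left w)

theorem continuous_kern_right (M : ℝ) (z : ℂ) : Continuous fun w => kern M z w := by
  change Continuous ((fun p : ℂ × ℂ => kern M p.1 p.2) ∘ fun w => (z, w))
  exact (continuous_kern M).comp (Continuous.prodMk_right z)

theorem kern_eq_zero (hM : 0 < M) (h : M ≤ ‖z - w‖) : kern M z w = 0 := by
  have h1 : z ≠ w := by
    rintro rfl
    simp at h
    linarith
  rw [kern_of_ne hM h1, ENNReal.ofReal_eq_zero, sub_nonpos]
  exact Real.log_le_log hM h

theorem kern_pos (h : ‖z - w‖ < M) : 0 < kern M z w := by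
  have hM : 0 < M := (norm_nonneg _).trans_lt h
  by_cases h1 : z = w
  · simp [h1, kern_self hM]
  · rw [kern_of_ne hM h1, ENNReal.ofReal_pos, sub_pos]
    exact Real.log_lt_log (norm_pos_iff.2 (sub_ne_zero.2 h1)) h

theorem kern_eq_of_sub_eq {z' w' : ℂ} (h : z - w = z' - w') : kern M z w = kern M z' w' := by
  simp [kern, h]

theorem kern_le (hM : 0 < M) {d : ℝ} (hd : 0 < d) (h : d ≤ ‖z - w‖) :
    kern M z w ≤ ENNReal.ofReal (Real.log M - Real.log d) := by
  have h1 : z ≠ w := by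
    rintro rfl
    simp at h
    linarith
  rw [kern_of_ne hM h1]
  exact ENNReal.ofReal_le_ofReal (sub_le_sub_left (Real.log_le_log hd h) _)

theorem le_kern (hM : 0 < M) {d : ℝ} (h : ‖z - w‖ ≤ d) :
    ENNReal.ofReal (Real.log M - Real.log d) ≤ kern M z w := by
  by_cases h1 : z = w
  · simp [h1, kern_self hM]
  · rw [kern_of_ne hM h1]
    exact ENNReal.ofReal_le_ofReal (sub_le_sub_left
      (Real.log_le_log (norm_pos_iff.2 (sub_ne_zero.2 h1)) h) _)

theorem lintegral_kern_left (M : ℝ) (w : ℂ) : ∫⁻ z, kern M z w = ∫⁻ z, kern M z 0 := by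
  rw [← lintegral_sub_right_eq_self (fun z => kern M z 0) w]
  refine lintegral_congr fun z => kern_eq_of_sub_eq (by simp)

/-- In polar coordinates the factor t absorbs the singularity: t log(M/t) ≤ M on (0, M). -/
theorem lintegral_kern_lt_top (hM : 0 < M) (w : ℂ) : ∫⁻ z, kern M z w < ⊤ := by
  rw [lintegral_kern_left, ← Complex.lintegral_comp_polarCoord_symm]
  have hm : MeasurableSet (Set.Ioo (0 : ℝ) M ×ˢ Set.Ioo (-Real.pi) Real.pi) :=
    measurableSet_Ioo.prod measurableSet_Ioo
  calc ∫⁻ p in polarCoord.target, ENNReal.ofReal p.1 • kern M (Complex.polarCoord.symm p) 0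
      ≤ ∫⁻ p in polarCoord.target, (Set.Ioo (0 : ℝ) M ×ˢ Set.Ioo (-Real.pi) Real.pi).indicator
          (fun _ => ENNReal.ofReal M) p := by
        refine setLIntegral_mono' polarCoord.open_target.measurableSet fun p hp => ?_
        rw [polarCoord_target] at hp
        have hp0 : 0 < p.1 := hp.1
        have hn : ‖Complex.polarCoord.symm p - 0‖ = p.1 := by
          rw [sub_zero, Complex.norm_polarCoord_symm, abs_of_pos hp0]
        rcases lt_or_ge p.1 M with h | h
        · rw [Set.indicator_of_mem (show p ∈ Set.Ioo (0 : ℝ) M ×ˢ Set.Ioo (-Real.pi) Real.pi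
            from ⟨⟨hp0, h⟩, hp.2⟩)]
          have hne : Complex.polarCoord.symm p ≠ 0 := by
            rw [← norm_pos_iff, ← sub_zero (Complex.polarCoord.symm p), hn]
            exact hp0
          rw [kern_of_ne hM hne, hn, smul_eq_mul, ← ENNReal.ofReal_mul hp0.le]
          refine ENNReal.ofReal_le_ofReal ?_
          rw [← Real.log_div hM.ne' hp0.ne']
          calc p.1 * Real.log (M / p.1) ≤ p.1 * (M / p.1) := by
                gcongr
                exact Real.log_le_self (by positivity)
            _ = M := by field_simp
        · rw [kern_eq_zero hM (by rw [hn]; exact h)]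
          simp
    _ ≤ ∫⁻ p, (Set.Ioo (0 : ℝ) M ×ˢ Set.Ioo (-Real.pi) Real.pi).indicator
          (fun _ => ENNReal.ofReal M) p := setLIntegral_le_lintegral _ _
    _ < ⊤ := by
        rw [lintegral_indicator hm, setLIntegral_const, Measure.volume_eq_prod,
          Measure.prod_prod, Real.volume_Ioo, Real.volume_Ioo]
        finiteness

theorem lintegral_kern_pos (hM : 0 < M) (w : ℂ) : 0 < ∫⁻ z, kern M z w := by
  rw [lintegral_pos_iff_support (continuous_kern_left M w).measurable]
  refine (Metric.measure_ball_pos volume w hM).trans_le (measure_mono fun z hz => ?_)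
  exact (kern_pos (by rwa [Metric.mem_ball, dist_eq_norm] at hz)).ne'

theorem measurable_truncPotential (M : ℝ) (μ : Measure ℂ) [SFinite μ] :
    Measurable (truncPotential M μ) :=
  (continuous_kern M).measurable.lintegral_prod_right'

/-- Lower semicontinuity of potentials, by Fatou's lemma. -/
theorem truncPotential_le_liminf (M : ℝ) (μ : Measure ℂ) {u : ℕ → ℂ} {z : ℂ}
    (hu : Tendsto u atTop (𝓝 z)) :
    truncPotential M μ z ≤ liminf (fun n => truncPotential M μ (u n)) atTop := by
  calc truncPotential M μ z = ∫⁻ w, liminf (fun n => kern M (u n) w) atTop ∂μ := by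
        refine lintegral_congr fun w => ?_
        exact (((continuous_kern_left M w).tendsto z).comp hu).liminf_eq.symm
    _ ≤ _ := lintegral_liminf_le fun n => (continuous_kern_right M (u n)).measurable

theorem isClosed_truncPotential_le (M : ℝ) (μ : Measure ℂ) (c : ℝ≥0∞) :
    IsClosed {z | truncPotential M μ z ≤ c} := by
  refine isClosed_of_closure_subset fun z hz => ?_
  obtain ⟨u, hu, hlim⟩ := mem_closure_iff_seq_limit.1 hz
  refine (truncPotential_le_liminf M μ hlim).trans ?_
  exact liminf_le_of_frequently_le' (Frequently.of_forall hu)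

theorem truncPotential_add (M : ℝ) (μ ν : Measure ℂ) (z : ℂ) :
    truncPotential M (μ + ν) z = truncPotential M μ z + truncPotential M ν z :=
  lintegral_add_measure _ _ _

theorem truncPotential_smul (M : ℝ) (c : ℝ≥0∞) (μ : Measure ℂ) (z : ℂ) :
    truncPotential M (c • μ) z = c * truncPotential M μ z :=
  lintegral_smul_measure _ _

theorem lintegral_truncPotential_comm (M : ℝ) (μ ν : Measure ℂ) [SFinite μ] [SFinite ν] :
    ∫⁻ z, truncPotential M μ z ∂ν = ∫⁻ z, truncPotential M ν z ∂μ := by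
  simp only [truncPotential]
  rw [lintegral_lintegral_swap (continuous_kern M).measurable.aemeasurable]
  simp_rw [kern_comm M]

theorem truncEnergy_add (M : ℝ) (μ ν : Measure ℂ) [SFinite μ] [SFinite ν] :
    truncEnergy M (μ + ν) =
      truncEnergy M μ + 2 * ∫⁻ z, truncPotential M μ z ∂ν + truncEnergy M ν := by
  have hμ := measurable_truncPotential M μ
  have hν := measurable_truncPotential M ν
  simp only [truncEnergy, truncPotential_add]
  rw [lintegral_add_measure, lintegral_add_left hμ, lintegral_add_left hμ,
    lintegral_truncPotential_comm M ν μ]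
  ring

theorem truncEnergy_smul (M : ℝ) (c : ℝ≥0∞) (μ : Measure ℂ) [SFinite μ] :
    truncEnergy M (c • μ) = c ^ 2 * truncEnergy M μ := by
  simp only [truncEnergy, truncPotential_smul]
  rw [lintegral_smul_measure, lintegral_const_mul _ (measurable_truncPotential M μ), smul_eq_mul]
  ring

theorem truncEnergy_mono {μ ν : Measure ℂ} (h : μ ≤ ν) : truncEnergy M μ ≤ truncEnergy M ν :=
  lintegral_mono' h fun _ => lintegral_mono' h le_rfl

end Kernel

/-! ### Energy versus truncated energy. -/

section Energy

variable {M r : ℝ} {μ : Measure ℂ} {z w : ℂ}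

theorem logKernel_of_ne (h : z ≠ w) : logKernel z w = (Real.log ‖z - w‖ : ℝ) := by
  rw [logKernel, ← ofReal_norm, ENNReal.log_ofReal_of_pos (norm_pos_iff.2 (sub_ne_zero.2 h))]

/-- This is kern = log M - log|z-w| with negative parts moved across, so that it makes sense in [0,
∞]; on the diagonal both sides are ∞. The bound 1 ≤ M keeps log M nonnegative. -/
theorem kern_add_toENNReal_logKernel (hM : 1 ≤ M) (h : ‖z - w‖ ≤ M) :
    kern M z w + (logKernel z w).toENNReal =
      ENNReal.ofReal (Real.log M) + (-logKernel z w).toENNReal := by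
  have hM0 : 0 < M := by linarith
  by_cases hzw : z = w
  · simp [hzw, kern_self hM0, logKernel]
  · have h1 : 0 < ‖z - w‖ := norm_pos_iff.2 (sub_ne_zero.2 hzw)
    have h2 := Real.log_le_log h1 h
    have h3 := Real.log_nonneg hM
    rw [kern_of_ne hM0 hzw, logKernel_of_ne hzw, ← EReal.coe_neg, EReal.real_coe_toENNReal,
      EReal.real_coe_toENNReal]
    rcases le_total 0 (Real.log ‖z - w‖) with h4 | h4
    · rw [ENNReal.ofReal_of_nonpos (neg_nonpos.2 h4), ← ENNReal.ofReal_add (by linarith) h4]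
      simp
    · rw [ENNReal.ofReal_of_nonpos h4, ← ENNReal.ofReal_add h3 (by linarith)]
      simp [sub_eq_add_neg]

theorem truncEnergy_eq_lintegral_prod (M : ℝ) (μ : Measure ℂ) [SFinite μ] :
    truncEnergy M μ = ∫⁻ p, kern M p.1 p.2 ∂(μ.prod μ) :=
  (lintegral_prod _ (continuous_kern M).measurable.aemeasurable).symm

theorem ae_norm_sub_le [SFinite μ] (hμ : μ (Metric.closedBall 0 r)ᶜ = 0) (hM : 2 * r ≤ M) :
    ∀ᵐ p ∂(μ.prod μ), ‖p.1 - p.2‖ ≤ M := by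
  have h : ∀ᵐ z ∂μ, z ∈ Metric.closedBall (0 : ℂ) r := hμ
  filter_upwards [Measure.quasiMeasurePreserving_fst.ae h,
    Measure.quasiMeasurePreserving_snd.ae h] with p h1 h2
  rw [mem_closedBall_zero_iff] at h1 h2
  linarith [norm_sub_le p.1 p.2]

theorem truncEnergy_add_lintegral [SFinite μ] (hμ : μ (Metric.closedBall 0 r)ᶜ = 0)
    (hM1 : 1 ≤ M) (hM : 2 * r ≤ M) :
    truncEnergy M μ + ∫⁻ p, (logKernel p.1 p.2).toENNReal ∂(μ.prod μ) =
      ENNReal.ofReal (Real.log M) * (μ.prod μ) Set.univ +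
        ∫⁻ p, (-logKernel p.1 p.2).toENNReal ∂(μ.prod μ) := by
  rw [truncEnergy_eq_lintegral_prod, ← lintegral_add_left (continuous_kern M).measurable,
    ← lintegral_const, ← lintegral_add_left measurable_const]
  refine lintegral_congr_ae ?_
  filter_upwards [ae_norm_sub_le hμ hM] with p hp
  exact kern_add_toENNReal_logKernel hM1 hp

theorem lintegral_toENNReal_logKernel_lt_top [IsFiniteMeasure μ]
    (hμ : μ (Metric.closedBall 0 r)ᶜ = 0) (hM1 : 1 ≤ M) (hM : 2 * r ≤ M) :
    ∫⁻ p, (logKernel p.1 p.2).toENNReal ∂(μ.prod μ) < ⊤ := by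
  refine (lintegral_mono_ae (g := fun _ => ENNReal.ofReal (Real.log M)) ?_).trans_lt ?_
  · filter_upwards [ae_norm_sub_le hμ hM] with p hp
    rw [← EReal.real_coe_toENNReal, ← ENNReal.log_ofReal_of_pos (by linarith)]
    refine EReal.toENNReal_le_toENNReal (ENNReal.log_le_log ?_)
    rw [← ofReal_norm]
    exact ENNReal.ofReal_le_ofReal hp
  · rw [lintegral_const]
    finiteness

theorem energy_eq [IsProbabilityMeasure μ] (hμ : μ (Metric.closedBall 0 r)ᶜ = 0)
    (hM1 : 1 ≤ M) (hM : 2 * r ≤ M) :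
    energy μ = (Real.log M : EReal) - (truncEnergy M μ : EReal) := by
  have h1 := truncEnergy_add_lintegral hμ hM1 hM
  have h2 := lintegral_toENNReal_logKernel_lt_top hμ hM1 hM
  rw [energy, eintegral]
  rw [measure_univ, mul_one] at h1
  generalize (∫⁻ p, (logKernel p.1 p.2).toENNReal ∂(μ.prod μ)) = a at h1 h2 ⊢
  generalize (∫⁻ p, (-logKernel p.1 p.2).toENNReal ∂(μ.prod μ)) = b at h1 ⊢
  generalize truncEnergy M μ = e at h1 ⊢
  have h3 := Real.log_nonneg hM1
  lift a to NNReal using h2.ne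
  rcases eq_or_ne b ⊤ with rfl | hb
  · have he : e = ⊤ := by
      by_contra he
      lift e to NNReal using he
      simp [← ENNReal.coe_add] at h1
    simp [he]
  · have he : e ≠ ⊤ := by
      rintro rfl
      have : ENNReal.ofReal (Real.log M) + b ≠ ⊤ := by finiteness
      exact this (by rw [← h1]; simp)
    lift e to NNReal using he
    lift b to NNReal using hb
    have h4 := congrArg ENNReal.toReal h1
    rw [ENNReal.toReal_add (by simp) (by simp), ENNReal.toReal_add (by simp) (by simp),
      ENNReal.toReal_ofReal h3] at h4
    simp only [ENNReal.coe_toReal] at h4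
    have h5 : (a : ℝ) - b = Real.log M - e := by linarith
    simp only [EReal.coe_nnreal_eq_coe_real, ← EReal.coe_sub, h5]

theorem truncEnergy_lt_top_of_energy_ne_bot [IsFiniteMeasure μ]
    (hμ : μ (Metric.closedBall 0 r)ᶜ = 0) (hM1 : 1 ≤ M) (hM : 2 * r ≤ M) (h : energy μ ≠ ⊥) :
    truncEnergy M μ < ⊤ := by
  have h1 := truncEnergy_add_lintegral hμ hM1 hM
  have h2 : ∫⁻ p, (-logKernel p.1 p.2).toENNReal ∂(μ.prod μ) ≠ ⊤ := by
    intro h2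
    exact h (by rw [energy, eintegral, h2]; simp)
  refine lt_of_le_of_lt (le_self_add.trans h1.le) ?_
  finiteness

end Energy

/-! ### First variation of the energy. -/

section Variation

variable {M r : ℝ} {K : Set ℂ} {ω ν : Measure ℂ}

/-- A finite energy measure on `K` with least truncated energy among all probability measures
on `K`. -/
structure IsMinimizer (M : ℝ) (K : Set ℂ) (ω : Measure ℂ) : Prop where
  measure_compl : ω Kᶜ = 0
  lt_top : truncEnergy M ω < ⊤
  le : ∀ ν : Measure ℂ, IsProbabilityMeasure ν → ν Kᶜ = 0 → truncEnergy M ω ≤ truncEnergy M ν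

/-- Compare ω with the normalization of ω + tν and look at the term of first order in t ≥ 0. -/
theorem IsMinimizer.mul_le_lintegral [IsProbabilityMeasure ω] [IsFiniteMeasure ν]
    (h : IsMinimizer M K ω) (hν : ν Kᶜ = 0) (hfin : truncEnergy M ν < ⊤) :
    truncEnergy M ω * ν Set.univ ≤ ∫⁻ z, truncPotential M ω z ∂ν := by
  rcases eq_or_ne (∫⁻ z, truncPotential M ω z ∂ν) ⊤ with hb | hb
  · simp [hb]
  have key : ∀ t : NNReal, truncEnergy M ω * (1 + t * ν Set.univ) ^ 2 ≤
      truncEnergy M ω + 2 * (t * ∫⁻ z, truncPotential M ω z ∂ν) + t ^ 2 * truncEnergy M ν := by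
    intro t
    set m : ℝ≥0∞ := 1 + t * ν Set.univ with hm
    have hm0 : m ≠ 0 := by simp [hm]
    have hmt : m ≠ ⊤ := by finiteness
    have hmass : (ω + (t : ℝ≥0∞) • ν) Set.univ = m := by simp [hm]
    have hprob : IsProbabilityMeasure (m⁻¹ • (ω + (t : ℝ≥0∞) • ν)) := by
      constructor
      rw [Measure.smul_apply, hmass, smul_eq_mul, ENNReal.inv_mul_cancel hm0 hmt]
    have h1 := h.le _ hprob (by simp [h.measure_compl, hν])
    rw [truncEnergy_smul, truncEnergy_add, truncEnergy_smul, lintegral_smul_measure,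
      smul_eq_mul] at h1
    calc truncEnergy M ω * m ^ 2 ≤ m⁻¹ ^ 2 * _ * m ^ 2 := by gcongr
      _ = (m⁻¹ * m) ^ 2 * (truncEnergy M ω + 2 * (t * ∫⁻ z, truncPotential M ω z ∂ν) +
            t ^ 2 * truncEnergy M ν) := by ring
      _ = _ := by rw [ENNReal.inv_mul_cancel hm0 hmt, one_pow, one_mul]
  have hm : ν Set.univ ≠ ⊤ := measure_ne_top _ _
  have he := h.lt_top.ne
  have hd := hfin.ne
  generalize truncEnergy M ω = e at *
  generalize truncEnergy M ν = d at *
  generalize (∫⁻ z, truncPotential M ω z ∂ν) = b at *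
  generalize ν Set.univ = m at *
  lift e to NNReal using he
  lift d to NNReal using hd
  lift b to NNReal using hb
  lift m to NNReal using hm
  norm_cast
  by_contra! hlt
  have hlt' : (b : ℝ) < e * m := by exact_mod_cast hlt
  have key' : ∀ t : ℝ, 0 ≤ t → (e : ℝ) * (1 + t * m) ^ 2 ≤ e + 2 * (t * b) + t ^ 2 * d := by
    intro t ht
    lift t to NNReal using ht
    exact_mod_cast key t
  set δ : ℝ := e * m - b with hδ
  have hδ0 : 0 < δ := by linarith
  have hd1 : (0 : ℝ) < d + 1 := by positivity
  -- This t makes t·d < δ, whereas `key'` demands 2δ ≤ t·d.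
  have ht : 0 < δ / (d + 1) := by positivity
  have h2 := key' _ ht.le
  set t := δ / (d + 1) with htdef
  have h3 : t * (d + 1) = δ := by rw [htdef]; field_simp
  have h4 : 0 ≤ e * (t * m) ^ 2 := by positivity
  have h5 : t * (2 * δ) ≤ t * (t * d) := by rw [hδ]; nlinarith
  have h6 := le_of_mul_le_mul_left h5 ht
  linarith

end Variation

/-! ### Lower bounds for the equilibrium potential almost everywhere. -/

section AlmostEverywhere

variable {M r : ℝ} {K : Set ℂ} {ω ν : Measure ℂ}

/-- Otherwise the restriction of ν to the set where the potential is below the energy violates the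
variational inequality. -/
theorem IsMinimizer.ae_le [IsProbabilityMeasure ω] [IsFiniteMeasure ν]
    (h : IsMinimizer M K ω) (hν : ν Kᶜ = 0) (hfin : truncEnergy M ν < ⊤) :
    ∀ᵐ z ∂ν, truncEnergy M ω ≤ truncPotential M ω z := by
  have hU := measurable_truncPotential M ω
  set A : Set ℂ := {z | truncPotential M ω z < truncEnergy M ω} with hA
  have hAm : MeasurableSet A := measurableSet_lt hU measurable_const
  suffices hA0 : ν A = 0 by
    rw [ae_iff]
    simpa only [not_le] using hA0
  by_contra hne
  have h1 := h.mul_le_lintegral (ν := ν.restrict A)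
    (Measure.absolutelyContinuous_of_le Measure.restrict_le_self hν)
    ((truncEnergy_mono Measure.restrict_le_self).trans_lt hfin)
  rw [Measure.restrict_apply_univ] at h1
  have h2 : ∫⁻ z in A, truncPotential M ω z ∂ν ≤ truncEnergy M ω * ν A := by
    rw [← setLIntegral_const]
    exact setLIntegral_mono measurable_const fun z hz => le_of_lt hz
  have h3 : ∫⁻ z in A, truncPotential M ω z ∂ν < ∫⁻ _ in A, truncEnergy M ω ∂ν := by
    refine setLIntegral_strict_mono hAm hne measurable_const ?_ (ae_of_all _ fun z hz => hz)
    exact (h2.trans_lt (ENNReal.mul_lt_top h.lt_top (measure_lt_top _ _))).ne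
  rw [setLIntegral_const] at h3
  exact absurd h1 h3.not_ge

theorem IsMinimizer.ae_eq [IsProbabilityMeasure ω] (h : IsMinimizer M K ω) :
    ∀ᵐ z ∂ω, truncPotential M ω z = truncEnergy M ω := by
  have h1 := h.ae_le h.measure_compl h.lt_top
  have h2 := ae_eq_of_ae_le_of_lintegral_le h1 (by simpa using h.lt_top.ne)
    (measurable_truncPotential M ω).aemeasurable (by simp [truncEnergy])
  filter_upwards [h2] with z hz using hz.symm

theorem truncEnergy_volume_restrict_lt_top (hM : 0 < M) (hK : IsCompact K) :
    truncEnergy M (volume.restrict K) < ⊤ := by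
  calc truncEnergy M (volume.restrict K)
      ≤ ∫⁻ _ in K, ∫⁻ w, kern M w 0 := by
        refine lintegral_mono fun z => (setLIntegral_le_lintegral _ _).trans (le_of_eq ?_)
        simp_rw [kern_comm M z]
        exact lintegral_kern_left M z
    _ < ⊤ := by
        rw [setLIntegral_const]
        exact ENNReal.mul_lt_top (lintegral_kern_lt_top hM 0) hK.measure_lt_top

/-- Lebesgue measure on K has finite truncated energy, so it may serve as ν; exceptional sets are
then Lebesgue null, and no notion of capacity is needed. -/
theorem IsMinimizer.ae_volume_le [IsProbabilityMeasure ω] (h : IsMinimizer M K ω) (hM : 0 < M)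
    (hK : IsCompact K) : ∀ᵐ z, z ∈ K → truncEnergy M ω ≤ truncPotential M ω z := by
  have : IsFiniteMeasure (volume.restrict K) := ⟨by
    rw [Measure.restrict_apply_univ]; exact hK.measure_lt_top⟩
  refine (ae_restrict_iff' hK.measurableSet).1 (h.ae_le ?_ ?_)
  · rw [Measure.restrict_apply hK.measurableSet.compl]
    simp
  · exact truncEnergy_volume_restrict_lt_top hM hK

end AlmostEverywhere

/-! ### Harmonicity of potentials off the support. -/

section Harmonic

variable {M r δ : ℝ} {μ : Measure ℂ} {z z₀ : ℂ}

/-- The logarithmic potential as a Bochner integral, for points away from the support. -/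
noncomputable def logPotential (μ : Measure ℂ) (z : ℂ) : ℝ := ∫ w, Real.log ‖z - w‖ ∂μ

theorem ae_le_norm_sub (h : μ (Metric.ball z δ) = 0) : ∀ᵐ w ∂μ, δ ≤ ‖z - w‖ := by
  have h1 : ∀ᵐ w ∂μ, w ∉ Metric.ball z δ := measure_eq_zero_iff_ae_notMem.1 h
  filter_upwards [h1] with w hw
  rwa [Metric.mem_ball, not_lt, dist_comm, dist_eq_norm] at hw

theorem integrable_log_norm_sub [IsFiniteMeasure μ] (hδ : 0 < δ) (h : μ (Metric.ball z δ) = 0)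
    (hμ : μ (Metric.closedBall 0 r)ᶜ = 0) : Integrable (fun w => Real.log ‖z - w‖) μ := by
  have h2 : ∀ᵐ w ∂μ, w ∈ Metric.closedBall (0 : ℂ) r := hμ
  refine Integrable.of_bound (C := max |Real.log δ| |Real.log (‖z‖ + r)|) ?_ ?_
  · exact (Real.measurable_log.comp (measurable_const.sub measurable_id).norm).aestronglyMeasurable
  · filter_upwards [ae_le_norm_sub h, h2] with w h3 h4
    rw [mem_closedBall_zero_iff] at h4
    rw [Real.norm_eq_abs]
    exact abs_le_max_abs_abs (Real.log_le_log hδ h3)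
      (Real.log_le_log (hδ.trans_le h3) (by linarith [norm_sub_le z w]))

theorem truncPotential_eq_ofReal [IsProbabilityMeasure μ] (hM : 0 < M) (hδ : 0 < δ)
    (h : μ (Metric.ball z δ) = 0) (hμ : μ (Metric.closedBall 0 r)ᶜ = 0) (hz : ‖z‖ + r ≤ M) :
    truncPotential M μ z = ENNReal.ofReal (Real.log M - logPotential μ z) := by
  have h2 : ∀ᵐ w ∂μ, w ∈ Metric.closedBall (0 : ℂ) r := hμ
  have hint := integrable_log_norm_sub hδ h hμ
  have h3 : Real.log M - logPotential μ z = ∫ w, (Real.log M - Real.log ‖z - w‖) ∂μ := by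
    rw [integral_sub (integrable_const _) hint]
    simp [logPotential]
  have h4 : Integrable (fun w => Real.log M - Real.log ‖z - w‖) μ := (integrable_const _).sub hint
  rw [h3, ofReal_integral_eq_lintegral_ofReal h4]
  · refine lintegral_congr_ae ?_
    filter_upwards [ae_le_norm_sub h] with w hw
    refine kern_of_ne hM ?_
    rintro rfl
    simp at hw
    linarith
  · filter_upwards [ae_le_norm_sub h, h2] with w h4 h5
    rw [mem_closedBall_zero_iff] at h5
    exact sub_nonneg.2 (Real.log_le_log (hδ.trans_le h4) (by linarith [norm_sub_le z w]))

/-- Write log|z-w| = log|z₀-w| + Re Log(1 - (z-z₀)/(w-z₀)). The quotient has modulus at most 1/2, so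
the principal branch is holomorphic in z, and one differentiates under the integral. -/
theorem exists_differentiableOn_logPotential_eq_re [IsFiniteMeasure μ] (hδ : 0 < δ)
    (h : μ (Metric.ball z₀ δ) = 0) (hμ : μ (Metric.closedBall 0 r)ᶜ = 0) :
    ∃ F : ℂ → ℂ, DifferentiableOn ℂ F (Metric.ball z₀ (δ / 2)) ∧
      ∀ z ∈ Metric.ball z₀ (δ / 2), logPotential μ z = (F z).re := by
  have hfar := ae_le_norm_sub h
  have hint := integrable_log_norm_sub hδ h hμ
  set f : ℂ → ℂ → ℂ := fun z w =>
    (Real.log ‖z₀ - w‖ : ℂ) + Complex.log (1 + -((z - z₀) / (w - z₀))) with hf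
  have hsmall : ∀ z ∈ Metric.ball z₀ (δ / 2), ∀ w, δ ≤ ‖z₀ - w‖ →
      ‖-((z - z₀) / (w - z₀))‖ ≤ 1 / 2 := by
    intro z hz w hw
    rw [Metric.mem_ball, dist_eq_norm] at hz
    rw [norm_neg, norm_div, norm_sub_rev w z₀, div_le_iff₀ (hδ.trans_le hw)]
    linarith
  have hmeas : ∀ z, Measurable (f z) := by
    intro z
    refine (Complex.measurable_ofReal.comp
      (Real.measurable_log.comp (measurable_const.sub measurable_id).norm)).add ?_
    exact Complex.measurable_log.comp (measurable_const.add
      (measurable_const.div (measurable_id.sub measurable_const)).neg)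
  have hfint : ∀ z ∈ Metric.ball z₀ (δ / 2), Integrable (f z) μ := by
    intro z hz
    refine Integrable.mono' (g := fun w => ‖Real.log ‖z₀ - w‖‖ + 1) (hint.norm.add
      (integrable_const _)) (hmeas z).aestronglyMeasurable ?_
    filter_upwards [hfar] with w hw
    refine (norm_add_le _ _).trans (add_le_add (by simp) ?_)
    have := hsmall z hz w hw
    linarith [Complex.norm_log_one_add_half_le_self this]
  refine ⟨fun z => ∫ w, f z w ∂μ, ?_, ?_⟩
  · intro z hz
    refine (hasDerivAt_integral_of_dominated_loc_of_deriv_le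
      (F' := fun z w => (z - w)⁻¹) (bound := fun _ => (δ / 2)⁻¹) (Metric.isOpen_ball.mem_nhds hz)
      (Eventually.of_forall fun z => (hmeas z).aestronglyMeasurable) (hfint z hz)
      ?_ ?_ (integrable_const _) ?_).2.differentiableAt.differentiableWithinAt
    · exact (measurable_const.sub measurable_id).inv.aestronglyMeasurable
    · filter_upwards [hfar] with w hw y hy
      rw [Metric.mem_ball, dist_eq_norm, norm_sub_rev] at hy
      rw [norm_inv]
      refine inv_anti₀ (by positivity) ?_
      have : z₀ - w = (z₀ - y) + (y - w) := by ring
      rw [this] at hw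
      linarith [norm_add_le (z₀ - y) (y - w)]
    · filter_upwards [hfar] with w hw y hy
      have h1 := hsmall y hy w hw
      have hw0 : w - z₀ ≠ 0 := by
        rw [← norm_pos_iff, norm_sub_rev]
        exact hδ.trans_le hw
      have h2 : 1 + -((y - z₀) / (w - z₀)) ∈ Complex.slitPlane :=
        Complex.mem_slitPlane_of_norm_lt_one (by linarith)
      have h3 : HasDerivAt (fun y => 1 + -((y - z₀) / (w - z₀))) (-(1 / (w - z₀))) y :=
        ((((hasDerivAt_id y).sub_const z₀).div_const (w - z₀)).neg).const_add 1
      have h4 := (h3.clog h2).const_add (Real.log ‖z₀ - w‖ : ℂ)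
      convert h4 using 1
      have h5 := Complex.slitPlane_ne_zero h2
      have h6 : 1 + -((y - z₀) / (w - z₀)) = (w - y) / (w - z₀) := by
        field_simp
        ring
      rw [h6] at h5 ⊢
      have h7 : w - y ≠ 0 := fun h => h5 (by simp [h])
      have h8 : y - w ≠ 0 := fun h => h7 (by rw [← neg_sub, h, neg_zero])
      field_simp
      ring
  · intro z hz
    change _ = Complex.reCLM (∫ w, f z w ∂μ)
    rw [← Complex.reCLM.integral_comp_comm (hfint z hz)]
    refine integral_congr_ae ?_
    filter_upwards [hfar] with w hw
    have h1 := hsmall z hz w hw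
    have hw0 : w - z₀ ≠ 0 := by
      rw [← norm_pos_iff, norm_sub_rev]
      exact hδ.trans_le hw
    have h5 := Complex.slitPlane_ne_zero
      (Complex.mem_slitPlane_of_norm_lt_one (lt_of_le_of_lt h1 (by norm_num)))
    have h6 : w - z = (w - z₀) * (1 + -((z - z₀) / (w - z₀))) := by
      field_simp
      ring
    simp only [hf, Complex.reCLM_apply, Complex.add_re, Complex.ofReal_re, Complex.log_re]
    rw [norm_sub_rev z w, h6, norm_mul, Real.log_mul (norm_ne_zero_iff.2 hw0)
      (norm_ne_zero_iff.2 h5), norm_sub_rev z₀ w]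

end Harmonic

/-! ### Continuity principle, maximum principle and Frostman's theorem. -/

section Frostman

variable {M r : ℝ} {K S : Set ℂ} {ω : Measure ℂ} {e : ℝ≥0∞}

/-- Moves a pole-side estimate from u to a comparison point ζ; the hypothesis excludes an infinite
left side against a finite right side. -/
theorem kern_le_kern_add {ζ u w : ℂ} (hM : 0 < M) (h : u = w → ζ = w) :
    kern M u w ≤ kern M ζ w + ENNReal.ofReal (Real.log (‖ζ - w‖ / ‖u - w‖)) := by
  by_cases h1 : ζ = w
  · simp [h1, kern_self hM]
  · have h2 : u ≠ w := fun h2 => h1 (h h2)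
    have h3 : ‖ζ - w‖ ≠ 0 := norm_ne_zero_iff.2 (sub_ne_zero.2 h1)
    have h4 : ‖u - w‖ ≠ 0 := norm_ne_zero_iff.2 (sub_ne_zero.2 h2)
    rw [kern_of_ne hM h1, kern_of_ne hM h2, Real.log_div h3 h4]
    refine le_trans (ENNReal.ofReal_le_ofReal ?_) ENNReal.ofReal_add_le
    linarith

/-- A potential bounded by `e` on a closed set carrying the measure has upper limits at most `e`
at the points of that set. -/
theorem eventually_truncPotential_lt [IsFiniteMeasure ω] (hM : 0 < M) (hS : IsClosed S)
    (hωS : ω Sᶜ = 0) (he : e ≠ ⊤) (hle : ∀ z ∈ S, truncPotential M ω z ≤ e) {u : ℕ → ℂ} {z : ℂ}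
    (hz : z ∈ S) (hu : Tendsto u atTop (𝓝 z)) {c : ℝ≥0∞} (hc : e < c) :
    ∀ᶠ n in atTop, truncPotential M ω (u n) < c := by
  -- Compare u n with a nearest point ζ n of S. For w in S this gives |ζ n - w| ≤ 2|u n - w|, so the
  -- error term is dominated by log 2, and it tends to 0 for w ≠ z.
  have hnear : ∀ n, ∃ ζ ∈ S, ∀ w ∈ S, ‖u n - ζ‖ ≤ ‖u n - w‖ := by
    intro n
    obtain ⟨ζ, hζ, h⟩ := hS.exists_infDist_eq_dist ⟨z, hz⟩ (u n)
    refine ⟨ζ, hζ, fun w hw => ?_⟩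
    rw [← dist_eq_norm, ← h, ← dist_eq_norm]
    exact Metric.infDist_le_dist_of_mem hw
  choose ζ hζS hζ using hnear
  have hatom : ω {z} = 0 := by
    by_contra hne
    have h1 : ∫⁻ w in {z}, kern M z w ∂ω ≤ truncPotential M ω z := setLIntegral_le_lintegral _ _
    rw [lintegral_singleton, kern_self hM, ENNReal.top_mul hne] at h1
    exact he (top_le_iff.1 (h1.trans (hle z hz)))
  have hae : ∀ᵐ w ∂ω, w ∈ S := hωS
  have hane : ∀ᵐ w ∂ω, w ≠ z := by
    rw [ae_iff]
    simpa using hatom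
  have hζlim : Tendsto ζ atTop (𝓝 z) := by
    have h0 : Tendsto (fun n => ‖u n - z‖ + ‖u n - z‖) atTop (𝓝 0) := by
      have := (tendsto_iff_norm_sub_tendsto_zero.1 hu)
      simpa using this.add this
    refine tendsto_iff_norm_sub_tendsto_zero.2 (squeeze_zero (fun _ => norm_nonneg _) ?_ h0)
    intro n
    calc ‖ζ n - z‖ = ‖(u n - z) - (u n - ζ n)‖ := by congr 1; ring
      _ ≤ ‖u n - z‖ + ‖u n - ζ n‖ := norm_sub_le _ _
      _ ≤ _ := by gcongr; exact hζ n z hz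
  set f : ℕ → ℂ → ℝ≥0∞ := fun n w => ENNReal.ofReal (Real.log (‖ζ n - w‖ / ‖u n - w‖)) with hf
  have hfm : ∀ n, Measurable (f n) := fun n => (Real.measurable_log.comp
    ((measurable_const.sub measurable_id).norm.div
      (measurable_const.sub measurable_id).norm)).ennreal_ofReal
  have hlim : Tendsto (fun n => ∫⁻ w, f n w ∂ω) atTop (𝓝 (∫⁻ _, 0 ∂ω)) := by
    refine tendsto_lintegral_of_dominated_convergence (fun _ => ENNReal.ofReal (Real.log 2)) hfm
      ?_ ?_ ?_
    · intro n
      filter_upwards [hae] with w hw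
      refine ENNReal.ofReal_le_ofReal ?_
      rcases (div_nonneg (norm_nonneg (ζ n - w)) (norm_nonneg (u n - w))).eq_or_lt with h0 | h0
      · rw [← h0, Real.log_zero]
        exact Real.log_nonneg (by norm_num)
      · refine Real.log_le_log h0 ?_
        refine div_le_of_le_mul₀ (norm_nonneg _) (by norm_num) ?_
        calc ‖ζ n - w‖ = ‖(u n - w) - (u n - ζ n)‖ := by congr 1; ring
          _ ≤ ‖u n - w‖ + ‖u n - ζ n‖ := norm_sub_le _ _
          _ ≤ _ := by linarith [hζ n w hw]
    · rw [lintegral_const]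
      finiteness
    · filter_upwards [hane] with w hw
      have hne : ‖z - w‖ ≠ 0 := norm_ne_zero_iff.2 (sub_ne_zero.2 hw.symm)
      have h1 : Tendsto (fun n => ‖ζ n - w‖ / ‖u n - w‖) atTop (𝓝 (‖z - w‖ / ‖z - w‖)) :=
        (hζlim.sub_const w).norm.div (hu.sub_const w).norm hne
      rw [div_self hne] at h1
      have h2 := ((Real.continuousAt_log one_ne_zero).tendsto.comp h1)
      rw [Real.log_one] at h2
      have h3 := (ENNReal.continuous_ofReal.tendsto 0).comp h2
      rwa [ENNReal.ofReal_zero] at h3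
  rw [lintegral_zero] at hlim
  have hlim2 := (tendsto_const_nhds (x := e)).add hlim
  rw [add_zero] at hlim2
  filter_upwards [hlim2.eventually_lt_const hc] with n hn
  refine lt_of_le_of_lt ?_ hn
  calc truncPotential M ω (u n) ≤ ∫⁻ w, kern M (ζ n) w + f n w ∂ω := by
        refine lintegral_mono_ae ?_
        filter_upwards [hae] with w hw
        refine kern_le_kern_add hM fun h => ?_
        have := hζ n w hw
        rw [h, sub_self, norm_zero, norm_le_zero_iff, sub_eq_zero] at this
        exact this.symm
    _ = truncPotential M ω (ζ n) + ∫⁻ w, f n w ∂ω :=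
        lintegral_add_left (continuous_kern_right M _).measurable _
    _ ≤ _ := by gcongr; exact hle _ (hζS n)

theorem exists_differentiableOn_truncPotential_eq [IsProbabilityMeasure ω] {δ : ℝ} {z₀ : ℂ}
    (hM : 0 < M) (hδ : 0 < δ) (h : ω (Metric.ball z₀ δ) = 0)
    (hω : ω (Metric.closedBall 0 r)ᶜ = 0) (hz : ‖z₀‖ + r < M) :
    ∃ ε > 0, ∃ F : ℂ → ℂ, DifferentiableOn ℂ F (Metric.ball z₀ ε) ∧
      ∀ z ∈ Metric.ball z₀ ε, truncPotential M ω z = ENNReal.ofReal (Real.log M - (F z).re) := by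
  obtain ⟨F, hF, hF'⟩ := exists_differentiableOn_logPotential_eq_re hδ h hω
  refine ⟨min (δ / 2) (M - r - ‖z₀‖), lt_min (by linarith) (by linarith), F,
    hF.mono (Metric.ball_subset_ball (min_le_left _ _)), fun z hz' => ?_⟩
  have h1 := Metric.ball_subset_ball (min_le_left _ _) hz'
  have h2 := Metric.ball_subset_ball (min_le_right _ _) hz'
  rw [← hF' z h1]
  rw [Metric.mem_ball] at h1
  refine truncPotential_eq_ofReal hM (half_pos hδ) (measure_mono_null ?_ h) hω ?_
  · intro w hw
    rw [Metric.mem_ball] at hw ⊢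
    linarith [dist_triangle w z z₀]
  · rw [Metric.mem_ball, dist_eq_norm] at h2
    have : ‖z‖ ≤ ‖z - z₀‖ + ‖z₀‖ := by simpa using norm_add_le (z - z₀) z₀
    linarith

/-- Maximum principle: a potential which is bounded by `e` on a closed set carrying the measure
and outside a bounded set is bounded by `e` everywhere. -/
theorem truncPotential_le_of_le_on [IsProbabilityMeasure ω] {ρ : ℝ} (hM : 0 < M)
    (hω : ω (Metric.closedBall 0 r)ᶜ = 0) (hρ : ρ + r ≤ M) (he : e ≠ ⊤)
    (hωS : ω {z | truncPotential M ω z ≤ e}ᶜ = 0)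
    (hout : ∀ z : ℂ, ρ ≤ ‖z‖ → truncPotential M ω z ≤ e) (z : ℂ) : truncPotential M ω z ≤ e := by
  set U := truncPotential M ω with hU
  set S : Set ℂ := {z | U z ≤ e} with hSdef
  have hS : IsClosed S := isClosed_truncPotential_le M ω e
  have hin : ∀ z, e < U z → ‖z‖ < ρ := fun z hz => by
    by_contra! h
    exact absurd (hout z h) hz.not_ge
  have hharm : ∀ z, e < U z → ∃ ε > 0, ∃ F : ℂ → ℂ, DifferentiableOn ℂ F (Metric.ball z ε) ∧
      ∀ y ∈ Metric.ball z ε, U y = ENNReal.ofReal (Real.log M - (F y).re) := by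
    intro z hz
    obtain ⟨δ, hδ, hball⟩ := Metric.isOpen_iff.1 hS.isOpen_compl z (fun h => hz.not_ge h)
    exact exists_differentiableOn_truncPotential_eq hM hδ (measure_mono_null hball hωS) hω
      (by linarith [hin z hz])
  set m : ℝ≥0∞ := ⨆ z, U z with hm
  by_contra! hz
  have hem : e < m := hz.trans_le (le_iSup U z)
  -- Limits of maximizing sequences are maximum points: the continuity principle excludes limits in
  -- S, and off S the potential is continuous. Hence the supremum is attained, on a compact set A.
  have hlimit : ∀ (u : ℕ → ℂ) (y : ℂ), Tendsto u atTop (𝓝 y) →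
      Tendsto (fun n => U (u n)) atTop (𝓝 m) → U y = m := by
    intro u y hu hUu
    rcases le_or_gt (U y) e with hy | hy
    · exfalso
      obtain ⟨c, hc1, hc2⟩ := exists_between hem
      obtain ⟨n, hn1, hn2⟩ := ((eventually_truncPotential_lt hM hS hωS he (fun z hz => hz) hy hu
        hc1).and (hUu.eventually_const_lt hc2)).exists
      exact lt_asymm hn1 hn2
    · obtain ⟨ε, hε, F, hF, hFU⟩ := hharm y hy
      have hnhds := Metric.ball_mem_nhds y hε
      have hcont : ContinuousAt U y := by
        have h1 : ContinuousAt F y := (hF.differentiableAt hnhds).continuousAt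
        have h2 : ContinuousAt (fun x => ENNReal.ofReal (Real.log M - (F x).re)) y :=
          ENNReal.continuous_ofReal.continuousAt.comp
            (continuousAt_const.sub (Complex.continuous_re.continuousAt.comp h1))
        refine h2.congr ?_
        filter_upwards [hnhds] with x hx using (hFU x hx).symm
      exact tendsto_nhds_unique (hcont.tendsto.comp hu) hUu
  set A : Set ℂ := {z | U z = m} with hA
  have hAbdd : A ⊆ Metric.closedBall 0 ρ := fun y hy => by
    rw [mem_closedBall_zero_iff]
    exact (hin y (by rw [show U y = m from hy]; exact hem)).le
  have hAclosed : IsClosed A := by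
    refine isClosed_of_closure_subset fun y hy => ?_
    obtain ⟨u, hu, hlim⟩ := mem_closure_iff_seq_limit.1 hy
    refine hlimit u y hlim ?_
    rw [show (fun n => U (u n)) = fun _ => m from funext hu]
    exact tendsto_const_nhds
  have hAne : A.Nonempty := by
    obtain ⟨v, -, hv, hvmem⟩ := exists_seq_tendsto_sSup (Set.range_nonempty U) (OrderTop.bddAbove _)
    choose u hu using hvmem
    have hv' : Tendsto (fun n => U (u n)) atTop (𝓝 m) := by
      simp only [hu]
      exact hv
    have hfreq : ∃ᶠ n in atTop, u n ∈ Metric.closedBall (0 : ℂ) ρ := by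
      refine Eventually.frequently ?_
      filter_upwards [hv'.eventually_const_lt hem] with n hn
      rw [mem_closedBall_zero_iff]
      exact (hin _ hn).le
    obtain ⟨y, -, φ, hφ, hlim⟩ := tendsto_subseq_of_frequently_bounded Metric.isBounded_closedBall
      hfreq
    exact ⟨y, hlimit _ y hlim (hv'.comp hφ.tendsto_atTop)⟩
  have hAcomp : IsCompact A :=
    (isCompact_closedBall (0 : ℂ) ρ).of_isClosed_subset hAclosed hAbdd
  -- At a rightmost point of A the maximum modulus principle for exp(-F) makes A a neighbourhood of
  -- the point, which is absurd.
  obtain ⟨a, haA, hamax⟩ := hAcomp.exists_isMaxOn hAne Complex.continuous_re.continuousOn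
  have haU : U a = m := haA
  obtain ⟨ε, hε, F, hF, hFU⟩ := hharm a (by rw [haU]; exact hem)
  have hnhds := Metric.ball_mem_nhds a hε
  have hpos : 0 < U a := by rw [haU]; exact (zero_le).trans_lt hem
  have hmaxloc : IsLocalMax (norm ∘ fun y => Complex.exp (-F y)) a := by
    filter_upwards [hnhds] with y hy
    have h1 : U y ≤ U a := by rw [haU]; exact le_iSup U y
    rw [hFU a (Metric.mem_ball_self hε), ENNReal.ofReal_pos] at hpos
    rw [hFU y hy, hFU a (Metric.mem_ball_self hε), ENNReal.ofReal_le_ofReal_iff hpos.le] at h1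
    simp only [Function.comp_apply, Complex.norm_exp, Complex.neg_re]
    exact Real.exp_le_exp.2 (by linarith)
  have hconst := Complex.eventually_eq_of_isLocalMax_norm (by
    filter_upwards [Metric.isOpen_ball.mem_nhds (Metric.mem_ball_self hε)] with y hy
    exact ((hF.differentiableAt (Metric.isOpen_ball.mem_nhds hy)).neg).cexp) hmaxloc
  have hA_nhds : A ∈ 𝓝 a := by
    filter_upwards [hconst, hnhds] with y hy hyb
    have h1 := congrArg norm hy
    rw [Complex.norm_exp, Complex.norm_exp, Real.exp_eq_exp, Complex.neg_re, Complex.neg_re,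
      neg_inj] at h1
    rw [hA, Set.mem_ofPred_eq, ← haU, hFU y hyb, h1, ← hFU a (Metric.mem_ball_self hε)]
  obtain ⟨η, hη, hball⟩ := Metric.mem_nhds_iff.1 hA_nhds
  have hmem : a + ((η / 2 : ℝ) : ℂ) ∈ A := by
    refine hball ?_
    rw [Metric.mem_ball, dist_eq_norm, add_sub_cancel_left, Complex.norm_real, Real.norm_eq_abs,
      abs_of_pos (half_pos hη)]
    exact half_lt_self hη
  have := hamax hmem
  simp only [Set.mem_ofPred_eq, Complex.add_re, Complex.ofReal_re] at this
  linarith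

/-- Frostman's theorem: the truncated potential of a minimizer never exceeds its energy. -/
theorem IsMinimizer.truncPotential_le [IsProbabilityMeasure ω] (hr : 0 < r)
    (h : IsMinimizer (10 * r) K ω) (hK : K ⊆ Metric.closedBall 0 r) (z : ℂ) :
    truncPotential (10 * r) ω z ≤ truncEnergy (10 * r) ω := by
  have hM : 0 < 10 * r := by positivity
  have hω : ω (Metric.closedBall 0 r)ᶜ = 0 :=
    measure_mono_null (Set.compl_subset_compl.2 hK) h.measure_compl
  have hball : ∀ᵐ w ∂ω, w ∈ Metric.closedBall (0 : ℂ) r := hω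
  have hlow : ENNReal.ofReal (Real.log (10 * r) - Real.log (2 * r)) ≤ truncEnergy (10 * r) ω := by
    calc ENNReal.ofReal (Real.log (10 * r) - Real.log (2 * r))
        = ∫⁻ _, ∫⁻ _, ENNReal.ofReal (Real.log (10 * r) - Real.log (2 * r)) ∂ω ∂ω := by simp
      _ ≤ _ := by
        refine lintegral_mono_ae ?_
        filter_upwards [hball] with y hy
        refine lintegral_mono_ae ?_
        filter_upwards [hball] with w hw
        rw [mem_closedBall_zero_iff] at hy hw
        exact le_kern hM (by linarith [norm_sub_le y w])
  -- Points of the support are at most 2r apart, while from |y| ≥ 5r they are at least 2r away; so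
  -- outside this disc the potential is below `hlow`.
  refine truncPotential_le_of_le_on (ρ := 5 * r) hM hω (by linarith) h.lt_top.ne ?_ ?_ z
  · have : ∀ᵐ z ∂ω, z ∈ {z | truncPotential (10 * r) ω z ≤ truncEnergy (10 * r) ω} := by
      filter_upwards [h.ae_eq] with z hz using hz.le
    exact this
  · intro y hy
    refine le_trans ?_ hlow
    calc truncPotential (10 * r) ω y
        ≤ ∫⁻ _, ENNReal.ofReal (Real.log (10 * r) - Real.log (2 * r)) ∂ω := by
          refine lintegral_mono_ae ?_
          filter_upwards [hball] with w hw
          rw [mem_closedBall_zero_iff] at hw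
          exact kern_le hM (by positivity) (by linarith [norm_sub_norm_le y w])
      _ = _ := by simp

end Frostman

/-! ### Circle means and potentials at small scales. -/

section CircleAverage

variable {M ε r : ℝ} {z w : ℂ} {μ ν ω : Measure ℂ}

theorem measurable_kern_comp {α : Type*} [MeasurableSpace α] {f g : α → ℂ} (hf : Measurable f)
    (hg : Measurable g) (M : ℝ) : Measurable fun a => kern M (f a) (g a) := by
  change Measurable ((fun p : ℂ × ℂ => kern M p.1 p.2) ∘ fun a => (f a, g a))
  exact (continuous_kern M).measurable.comp (hf.prodMk hg)

/-- Angles, with Lebesgue measure. -/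
noncomputable abbrev angleMeasure : Measure ℝ := volume.restrict (Set.Ioc 0 (2 * Real.pi))

/-- The mean of log|· - w| over the circle is log max(ε, |z-w|); the bound on M keeps the kernel
untruncated there. -/
theorem lintegral_kern_circleMap (hε : 0 < ε) (hM : ‖z - w‖ + ε ≤ M) :
    ∫⁻ θ, kern M (circleMap z ε θ) w ∂angleMeasure = ENNReal.ofReal (2 * Real.pi) *
      ENNReal.ofReal (Real.log M - Real.log (max ε ‖z - w‖)) := by
  have hM0 : 0 < M := by linarith [norm_nonneg (z - w)]
  have h2pi : 0 < 2 * Real.pi := Real.two_pi_pos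
  have hne : ∀ᵐ θ ∂angleMeasure, circleMap z ε θ ≠ w := by
    refine ae_restrict_of_ae ?_
    rw [ae_iff]
    simpa [Set.preimage] using
      ((Set.countable_singleton w).preimage_circleMap z hε.ne').measure_zero volume
  have hbound : ∀ θ, ‖circleMap z ε θ - w‖ ≤ M := by
    intro θ
    have h1 : circleMap z ε θ - w = (z - w) + circleMap 0 ε θ := by
      simp [circleMap]
      ring
    rw [h1]
    refine (norm_add_le _ _).trans ?_
    rw [norm_circleMap_zero, abs_of_pos hε]
    exact hM
  have hint : IntegrableOn (fun θ => Real.log ‖circleMap z ε θ - w‖) (Set.Ioc 0 (2 * Real.pi)) := by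
    have h1 := circleIntegrable_log_norm_sub_const (a := w) (c := z) ε
    rw [CircleIntegrable, intervalIntegrable_iff_integrableOn_Ioc_of_le h2pi.le] at h1
    exact h1
  have hint2 : IntegrableOn (fun θ => Real.log M - Real.log ‖circleMap z ε θ - w‖)
      (Set.Ioc 0 (2 * Real.pi)) := (integrable_const _).sub hint
  have h1 : ∫⁻ θ, kern M (circleMap z ε θ) w ∂angleMeasure =
      ENNReal.ofReal (∫ θ, (Real.log M - Real.log ‖circleMap z ε θ - w‖) ∂angleMeasure) := by
    rw [ofReal_integral_eq_lintegral_ofReal hint2]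
    · refine lintegral_congr_ae ?_
      filter_upwards [hne] with θ hθ using kern_of_ne hM0 hθ
    · filter_upwards [hne] with θ hθ
      exact sub_nonneg.2 (Real.log_le_log (norm_pos_iff.2 (sub_ne_zero.2 hθ)) (hbound θ))
  have h2 : ∫ θ, Real.log ‖circleMap z ε θ - w‖ ∂angleMeasure =
      2 * Real.pi * Real.log (max ε ‖z - w‖) := by
    have h3 := circleAverage_log_norm_sub_const_eq_log_radius_add_posLog (a := w) (c := z) hε.ne'
    rw [Real.circleAverage, smul_eq_mul, intervalIntegral.integral_of_le h2pi.le,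
      inv_mul_eq_iff_eq_mul₀ h2pi.ne'] at h3
    rw [h3]
    congr 1
    rcases le_total ‖z - w‖ ε with h5 | h5
    · rw [max_eq_left h5, add_eq_left, Real.posLog_eq_zero_iff, abs_of_nonneg (by positivity),
        inv_mul_le_iff₀ hε, mul_one]
      exact h5
    · have h4 : 0 < ‖z - w‖ := hε.trans_le h5
      rw [max_eq_right h5, Real.posLog_eq_log, Real.log_mul (inv_pos.2 hε).ne' h4.ne', Real.log_inv]
      · ring
      · rw [abs_of_nonneg (by positivity)]
        exact (le_inv_mul_iff₀ hε).2 (by linarith)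
  rw [h1, integral_sub (integrable_const _) hint, h2, ← ENNReal.ofReal_mul h2pi.le]
  congr 1
  rw [integral_const, Measure.real, Measure.restrict_apply_univ, Real.volume_Ioc, sub_zero,
    ENNReal.toReal_ofReal h2pi.le, smul_eq_mul]
  ring

/-- The defect in the mean value property is exactly the kernel at scale ε. The additive form stays
valid at z = w. -/
theorem mul_kern_eq_lintegral_circleMap_add (hε : 0 < ε) (hM : ‖z - w‖ + ε ≤ M) :
    ENNReal.ofReal (2 * Real.pi) * kern M z w =
      ∫⁻ θ, kern M (circleMap z ε θ) w ∂angleMeasure +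
        ENNReal.ofReal (2 * Real.pi) * kern ε z w := by
  have hM0 : 0 < M := by linarith [norm_nonneg (z - w)]
  rw [lintegral_kern_circleMap hε hM, ← mul_add]
  congr 1
  by_cases hzw : z = w
  · simp [hzw, kern_self hε, kern_self hM0]
  · have h4 : 0 < ‖z - w‖ := norm_pos_iff.2 (sub_ne_zero.2 hzw)
    rw [kern_of_ne hM0 hzw, kern_of_ne hε hzw]
    rcases le_total ‖z - w‖ ε with h5 | h5
    · rw [max_eq_left h5, ← ENNReal.ofReal_add]
      · congr 1
        ring
      · exact sub_nonneg.2 (Real.log_le_log hε (by linarith [norm_nonneg (z - w)]))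
      · exact sub_nonneg.2 (Real.log_le_log h4 h5)
    · rw [max_eq_right h5, ENNReal.ofReal_of_nonpos (p := Real.log ε - _), add_zero]
      exact sub_nonpos.2 (Real.log_le_log hε h5)

theorem mul_truncPotential_eq_lintegral_circleMap_add [IsFiniteMeasure μ] (hε : 0 < ε)
    (hμ : μ (Metric.closedBall 0 r)ᶜ = 0) (hM : ‖z‖ + r + ε ≤ M) :
    ENNReal.ofReal (2 * Real.pi) * truncPotential M μ z =
      ∫⁻ θ, truncPotential M μ (circleMap z ε θ) ∂angleMeasure +
        ENNReal.ofReal (2 * Real.pi) * truncPotential ε μ z := by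
  have hball : ∀ᵐ w ∂μ, w ∈ Metric.closedBall (0 : ℂ) r := hμ
  have hm : Measurable (fun p : ℝ × ℂ => kern M (circleMap z ε p.1) p.2) :=
    measurable_kern_comp ((continuous_circleMap z ε).measurable.comp measurable_fst)
      measurable_snd M
  simp only [truncPotential]
  rw [lintegral_lintegral_swap (f := fun θ w => kern M (circleMap z ε θ) w) hm.aemeasurable,
    ← lintegral_const_mul _ (continuous_kern_right M z).measurable,
    ← lintegral_const_mul _ (continuous_kern_right ε z).measurable, ← lintegral_add_right _
      ((continuous_kern_right ε z).measurable.const_mul _)]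
  refine lintegral_congr_ae ?_
  filter_upwards [hball] with w hw
  rw [mem_closedBall_zero_iff] at hw
  exact mul_kern_eq_lintegral_circleMap_add hε (by linarith [norm_sub_le z w])

/-- Fubini: for fixed θ the map from z to the point of the circle is a translation. -/
theorem ae_ae_circleMap {p : ℂ → Prop} (hp : ∀ᵐ z, p z) (ε : ℝ) :
    ∀ᵐ z, ∀ᵐ θ ∂angleMeasure, p (circleMap z ε θ) := by
  obtain ⟨N, hN, hNm, hN0⟩ := exists_measurable_superset_of_null (ae_iff.1 hp)
  have hcont : Continuous fun x : ℂ × ℝ => circleMap x.1 ε x.2 := by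
    simp only [circleMap]
    fun_prop
  have h1 : ∀ᵐ z, ∀ᵐ θ ∂angleMeasure, circleMap z ε θ ∉ N := by
    rw [Measure.ae_ae_comm (p := fun z θ => circleMap z ε θ ∉ N)
      (hcont.measurable hNm.compl)]
    refine ae_of_all _ fun θ => ?_
    have h2 : ∀ᵐ z, z ∉ N := measure_eq_zero_iff_ae_notMem.1 hN0
    exact (measurePreserving_add_right volume ((ε : ℂ) *
      Complex.exp (θ * Complex.I))).quasiMeasurePreserving.ae h2
  filter_upwards [h1] with z hz
  filter_upwards [hz] with θ hθ
  by_contra h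
  exact hθ (hN h)

theorem truncPotential_eq_zero (hε : 0 < ε) (hμ : μ (Metric.closedBall 0 r)ᶜ = 0)
    (hz : r + ε ≤ ‖z‖) : truncPotential ε μ z = 0 := by
  have hball : ∀ᵐ w ∂μ, w ∈ Metric.closedBall (0 : ℂ) r := hμ
  rw [truncPotential, ← lintegral_zero (μ := μ)]
  refine lintegral_congr_ae ?_
  filter_upwards [hball] with w hw
  rw [mem_closedBall_zero_iff] at hw
  exact kern_eq_zero hε (by linarith [norm_sub_norm_le z w])

/-- If the potentials of two measures agree almost everywhere, then so do their potentials at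
small scales. -/
theorem ae_truncPotential_eq_of_ae_eq [IsFiniteMeasure μ] [IsFiniteMeasure ν] {e : ℝ≥0∞}
    (hε : 0 < ε) (hr : ε ≤ r) (hM : 4 * r ≤ M) (hμ : μ (Metric.closedBall 0 r)ᶜ = 0)
    (hν : ν (Metric.closedBall 0 r)ᶜ = 0) (he : e ≠ ⊤) (hle : ∀ z, truncPotential M μ z ≤ e)
    (h : ∀ᵐ z : ℂ, ‖z‖ ≤ 3 * r → truncPotential M μ z = truncPotential M ν z) :
    ∀ᵐ z, truncPotential ε μ z = truncPotential ε ν z := by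
  filter_upwards [h, ae_ae_circleMap h ε] with z hz hcirc
  rcases le_total (r + ε) ‖z‖ with h1 | h1
  · rw [truncPotential_eq_zero hε hμ h1, truncPotential_eq_zero hε hν h1]
  · have h2 := mul_truncPotential_eq_lintegral_circleMap_add (M := M) (z := z) hε hμ (by linarith)
    have h3 := mul_truncPotential_eq_lintegral_circleMap_add (M := M) (z := z) hε hν (by linarith)
    have hcirc' : ∀ᵐ θ ∂angleMeasure, truncPotential M μ (circleMap z ε θ) =
        truncPotential M ν (circleMap z ε θ) := by
      filter_upwards [hcirc] with θ hθ
      refine hθ ?_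
      have h5 : ‖circleMap z ε θ‖ ≤ ‖z‖ + ‖circleMap 0 ε θ‖ := by
        have h6 : circleMap z ε θ = z + circleMap 0 ε θ := by simp [circleMap]
        rw [h6]
        exact norm_add_le _ _
      rw [norm_circleMap_zero, abs_of_pos hε] at h5
      linarith
    rw [← hz (by linarith), ← lintegral_congr_ae hcirc', h2] at h3
    have hfin : ∫⁻ θ, truncPotential M μ (circleMap z ε θ) ∂angleMeasure ≠ ⊤ := by
      refine ((lintegral_mono fun θ => hle _).trans_lt ?_).ne
      rw [lintegral_const]
      finiteness
    have h4 := (ENNReal.add_right_inj hfin).1 h3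
    exact (ENNReal.mul_right_inj (by simpa using Real.pi_pos) ENNReal.ofReal_ne_top).1 h4

end CircleAverage

/-! ### Recovering a measure from its potential; no mass in the interior. -/

section Uniqueness

variable {M r : ℝ} {K : Set ℂ} {μ ν ω : Measure ℂ}

/-- The normalized kernels form an approximate identity: they vanish at distance ε or more, and
their mass does not depend on w. -/
theorem tendsto_average_kern (f : ℂ → ℝ≥0∞) (hf : Continuous f) (w : ℂ)
    (hw : f w ≠ ⊤) {ε : ℕ → ℝ} (hε : ∀ n, 0 < ε n) (hlim : Tendsto ε atTop (𝓝 0)) :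
    Tendsto (fun n => (∫⁻ z, kern (ε n) z 0)⁻¹ * ∫⁻ z, f z * kern (ε n) z w) atTop
      (𝓝 (f w)) := by
  rw [ENNReal.tendsto_nhds hw]
  intro η hη
  have h1 := (ENNReal.tendsto_nhds hw).1 (hf.tendsto w) η hη
  obtain ⟨δ, hδ, hball⟩ := Metric.eventually_nhds_iff_ball.1 h1
  filter_upwards [hlim.eventually_lt_const hδ] with n hn
  have hc0 : (∫⁻ z, kern (ε n) z 0) ≠ 0 := (lintegral_kern_pos (hε n) 0).ne'
  have hct : (∫⁻ z, kern (ε n) z 0) ≠ ⊤ := (lintegral_kern_lt_top (hε n) 0).ne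
  have hconst : ∀ a : ℝ≥0∞,
      (∫⁻ z, kern (ε n) z 0)⁻¹ * ∫⁻ z, a * kern (ε n) z w = a := by
    intro a
    rw [lintegral_const_mul _ (continuous_kern_left _ w).measurable, lintegral_kern_left _ w,
      mul_left_comm, ENNReal.inv_mul_cancel hc0 hct, mul_one]
  have hcases : ∀ z, kern (ε n) z w = 0 ∨ f z ∈ Set.Icc (f w - η) (f w + η) := by
    intro z
    rcases le_or_gt (ε n) ‖z - w‖ with h | h
    · exact Or.inl (kern_eq_zero (hε n) h)
    · refine Or.inr (hball z ?_)
      rw [Metric.mem_ball, dist_eq_norm]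
      exact h.trans hn
  constructor
  · rw [← hconst (f w - η)]
    refine mul_le_mul_right (lintegral_mono fun z => ?_) _
    rcases hcases z with h | h
    · simp [h]
    · exact mul_le_mul_left h.1 _
  · rw [← hconst (f w + η)]
    refine mul_le_mul_right (lintegral_mono fun z => ?_) _
    rcases hcases z with h | h
    · simp [h]
    · exact mul_le_mul_left h.2 _

theorem lintegral_lintegral_mul_kern [SFinite μ] {f : ℂ → ℝ≥0∞} (hf : Measurable f) (ε : ℝ) :
    ∫⁻ w, (∫⁻ z, f z * kern ε z w) ∂μ = ∫⁻ z, f z * truncPotential ε μ z := by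
  have hm : Measurable (fun p : ℂ × ℂ => f p.2 * kern ε p.2 p.1) :=
    (hf.comp measurable_snd).mul (measurable_kern_comp measurable_snd measurable_fst ε)
  rw [lintegral_lintegral_swap (f := fun w z => f z * kern ε z w) hm.aemeasurable]
  refine lintegral_congr fun z => ?_
  rw [truncPotential, lintegral_const_mul _ (continuous_kern_right ε z).measurable]

theorem measurable_lintegral_mul_kern {f : ℂ → ℝ≥0∞} (hf : Measurable f) (ε : ℝ) :
    Measurable fun w => ∫⁻ z, f z * kern ε z w := by
  have hm : Measurable (fun p : ℂ × ℂ => f p.2 * kern ε p.2 p.1) :=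
    (hf.comp measurable_snd).mul (measurable_kern_comp measurable_snd measurable_fst ε)
  exact hm.lintegral_prod_right'

/-- A measure is determined by its potential up to Lebesgue null sets. -/
theorem eq_of_ae_truncPotential_eq [IsFiniteMeasure μ] [IsFiniteMeasure ν] {e : ℝ≥0∞}
    (hr : 0 < r) (hM : 4 * r ≤ M) (hμ : μ (Metric.closedBall 0 r)ᶜ = 0)
    (hν : ν (Metric.closedBall 0 r)ᶜ = 0) (he : e ≠ ⊤) (hle : ∀ z, truncPotential M μ z ≤ e)
    (h : ∀ᵐ z : ℂ, ‖z‖ ≤ 3 * r → truncPotential M μ z = truncPotential M ν z) : μ = ν := by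
  refine ext_of_forall_lintegral_eq_of_IsFiniteMeasure fun f => ?_
  set g : ℂ → ℝ≥0∞ := fun z => f z with hg
  have hgc : Continuous g := ENNReal.continuous_coe.comp f.continuous
  set ε : ℕ → ℝ := fun n => r * (1 / ((n : ℝ) + 1)) with hεdef
  have hε : ∀ n, 0 < ε n := fun n => by positivity
  have hεr : ∀ n, ε n ≤ r := fun n => mul_le_of_le_one_right hr.le
    ((div_le_one (by positivity)).2 (by linarith [(Nat.cast_nonneg n : (0 : ℝ) ≤ n)]))
  have hlim : Tendsto ε atTop (𝓝 0) := by
    simpa only [mul_zero] using tendsto_one_div_add_atTop_nhds_zero_nat.const_mul r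
  obtain ⟨C, hC⟩ : ∃ C : NNReal, ∀ z, f z ≤ C := ⟨_, fun z => f.apply_le_nndist_zero z⟩
  -- By Tonelli, testing g against the normalized potential of τ at scale ε is testing the mollified
  -- g against τ.
  have key : ∀ (τ : Measure ℂ) [IsFiniteMeasure τ],
      Tendsto (fun n => (∫⁻ z, kern (ε n) z 0)⁻¹ * ∫⁻ z, g z * truncPotential (ε n) τ z) atTop
        (𝓝 (∫⁻ z, g z ∂τ)) := by
    intro τ _
    have h1 : Tendsto (fun n => ∫⁻ w, ((∫⁻ z, kern (ε n) z 0)⁻¹ *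
        ∫⁻ z, g z * kern (ε n) z w) ∂τ) atTop (𝓝 (∫⁻ z, g z ∂τ)) := by
      refine tendsto_lintegral_of_dominated_convergence (fun _ => (C : ℝ≥0∞)) ?_ ?_ ?_ ?_
      · exact fun n => (measurable_lintegral_mul_kern hgc.measurable _).const_mul _
      · intro n
        refine ae_of_all _ fun w => ?_
        calc (∫⁻ z, kern (ε n) z 0)⁻¹ * ∫⁻ z, g z * kern (ε n) z w
            ≤ (∫⁻ z, kern (ε n) z 0)⁻¹ * ∫⁻ z, C * kern (ε n) z w := by
              gcongr with z
              exact ENNReal.coe_le_coe.2 (hC z)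
          _ = C := by
              rw [lintegral_const_mul _ (continuous_kern_left _ w).measurable,
                lintegral_kern_left _ w, mul_left_comm, ENNReal.inv_mul_cancel
                (lintegral_kern_pos (hε n) 0).ne' (lintegral_kern_lt_top (hε n) 0).ne, mul_one]
      · rw [lintegral_const]
        finiteness
      · exact ae_of_all _ fun w => tendsto_average_kern g hgc w ENNReal.coe_ne_top hε hlim
    refine h1.congr fun n => ?_
    rw [lintegral_const_mul _ (measurable_lintegral_mul_kern hgc.measurable _),
      lintegral_lintegral_mul_kern hgc.measurable]
  refine tendsto_nhds_unique (key μ) ((key ν).congr fun n => ?_)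
  congr 1
  refine lintegral_congr_ae ?_
  filter_upwards [ae_truncPotential_eq_of_ae_eq (hε n) (hεr n) hM hμ hν he hle h] with z hz
  rw [hz]

/-- The equilibrium measure does not charge the interior. -/
theorem IsMinimizer.measure_interior [IsProbabilityMeasure ω] (hr : 0 < r)
    (h : IsMinimizer (10 * r) K ω) (hK : IsCompact K) (hKr : K ⊆ Metric.closedBall 0 r) :
    ω (interior K) = 0 := by
  have hω : ω (Metric.closedBall 0 r)ᶜ = 0 :=
    measure_mono_null (Set.compl_subset_compl.2 hKr) h.measure_compl
  have hle := h.truncPotential_le hr hKr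
  have heq : ∀ᵐ z, z ∈ K → truncPotential (10 * r) ω z = truncEnergy (10 * r) ω := by
    filter_upwards [h.ae_volume_le (by positivity) hK] with z hz hzK
    exact le_antisymm (hle z) (hz hzK)
  refine measure_null_of_locally_null _ fun a ha => ?_
  obtain ⟨δ, hδ, hball⟩ := Metric.isOpen_iff.1 isOpen_interior a ha
  set ε := min (δ / 3) r with hεdef
  have hε : 0 < ε := lt_min (by positivity) hr
  have hεδ : ε ≤ δ / 3 := min_le_left _ _
  have hεr : ε ≤ r := min_le_right _ _
  -- The centre a may be exceptional, so it is replaced by a nearby z whose circle is good for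
  -- almost every θ; ε ≤ δ/3 keeps that circle inside K.
  obtain ⟨z, hzcirc, hza⟩ : ∃ z, (∀ᵐ θ ∂angleMeasure, circleMap z ε θ ∈ K →
      truncPotential (10 * r) ω (circleMap z ε θ) = truncEnergy (10 * r) ω) ∧
      z ∈ Metric.ball a (ε / 2) := by
    have h1 : ∃ᵐ z, z ∈ Metric.ball a (ε / 2) :=
      frequently_ae_mem_iff.2 (Metric.measure_ball_pos volume a (half_pos hε)).ne'
    exact ((ae_ae_circleMap heq ε).and_frequently h1).exists
  rw [Metric.mem_ball] at hza
  have hzr : ‖z‖ ≤ r := by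
    rw [← mem_closedBall_zero_iff]
    refine hKr (interior_subset (hball ?_))
    rw [Metric.mem_ball]
    linarith
  have h2 := mul_truncPotential_eq_lintegral_circleMap_add (M := 10 * r) (z := z) hε hω
    (by linarith)
  have h3 : ∫⁻ θ, truncPotential (10 * r) ω (circleMap z ε θ) ∂angleMeasure =
      ENNReal.ofReal (2 * Real.pi) * truncEnergy (10 * r) ω := by
    have h4 : ∫⁻ θ, truncPotential (10 * r) ω (circleMap z ε θ) ∂angleMeasure =
        ∫⁻ _, truncEnergy (10 * r) ω ∂angleMeasure := by
      refine lintegral_congr_ae ?_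
      filter_upwards [hzcirc] with θ hθ
      refine hθ (interior_subset (hball ?_))
      have h5 : dist (circleMap z ε θ) z = ε := by
        rw [dist_eq_norm, circleMap_sub_center, norm_circleMap_zero, abs_of_pos hε]
      rw [Metric.mem_ball]
      linarith [dist_triangle (circleMap z ε θ) z a]
    rw [h4, lintegral_const, Measure.restrict_apply_univ, Real.volume_Ioc, sub_zero, mul_comm]
  -- The potential at z is the energy plus this term, and by Frostman it is at most the energy.
  have h6 : truncPotential ε ω z = 0 := by
    rw [h3, ← mul_add] at h2
    have h7 := (ENNReal.mul_right_inj (by simpa using Real.pi_pos) ENNReal.ofReal_ne_top).1 h2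
    have h8 := h7.symm.le.trans (hle z)
    by_contra hne
    exact absurd h8 (ENNReal.lt_add_right h.lt_top.ne hne).not_ge
  rw [truncPotential, lintegral_eq_zero_iff (continuous_kern_right ε z).measurable] at h6
  refine ⟨Metric.ball z ε, mem_nhdsWithin_of_mem_nhds (Metric.isOpen_ball.mem_nhds ?_), ?_⟩
  · rw [Metric.mem_ball, dist_comm]
    linarith
  · rw [measure_eq_zero_iff_ae_notMem]
    filter_upwards [h6] with w hw hwball
    rw [Metric.mem_ball, dist_comm, dist_eq_norm] at hwball
    exact (kern_pos hwball).ne' hw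

end Uniqueness

/-! ### From equality near infinity to equality of measures. -/

section Identity

variable {M r R : ℝ} {K : Set ℂ} {μ ν ω : Measure ℂ}

/-- The difference of two logarithmic potentials vanishes on a ball off the supports as soon as it
vanishes near one point of it. -/
theorem eqOn_ball_logPotential [IsFiniteMeasure μ] [IsFiniteMeasure ν] {δ : ℝ} {y z : ℂ}
    (hδ : 0 < δ) (hμ : μ (Metric.closedBall 0 r)ᶜ = 0) (hν : ν (Metric.closedBall 0 r)ᶜ = 0)
    (hμz : μ (Metric.ball z δ) = 0) (hνz : ν (Metric.ball z δ) = 0)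
    (hy : y ∈ Metric.ball z (δ / 2)) (h : logPotential μ =ᶠ[𝓝 y] logPotential ν) :
    Set.EqOn (logPotential μ) (logPotential ν) (Metric.ball z (δ / 2)) := by
  obtain ⟨F, hF, hFμ⟩ := exists_differentiableOn_logPotential_eq_re hδ hμz hμ
  obtain ⟨G, hG, hGν⟩ := exists_differentiableOn_logPotential_eq_re hδ hνz hν
  have hre : ∀ H : ℂ → ℂ, DifferentiableOn ℂ H (Metric.ball z (δ / 2)) →
      AnalyticOnNhd ℝ (fun x => (H x).re) (Metric.ball z (δ / 2)) := fun H hH =>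
    Complex.reCLM.comp_analyticOnNhd (hH.analyticOnNhd Metric.isOpen_ball).restrictScalars
  have h1 : (fun x => (F x).re) =ᶠ[𝓝 y] fun x => (G x).re := by
    filter_upwards [h, Metric.isOpen_ball.mem_nhds hy] with x hx hxb
    rw [← hFμ x hxb, ← hGν x hxb, hx]
  have h2 := (hre F hF).eqOn_of_preconnected_of_eventuallyEq (hre G hG)
    (convex_ball z (δ / 2)).isPreconnected hy h1
  intro x hx
  rw [hFμ x hx, hGν x hx]
  exact h2 hx

/-- If the logarithmic potentials of two measures on a polynomially convex compact set agree near
infinity, then they agree on the whole complement. -/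
theorem logPotential_eq_of_notMem [IsFiniteMeasure μ] [IsFiniteMeasure ν] (hK : IsCompact K)
    (hconv : PolynomiallyConvex K) (hμ : μ Kᶜ = 0) (hν : ν Kᶜ = 0)
    (h : ∀ z : ℂ, R < ‖z‖ → logPotential μ z = logPotential ν z) {z : ℂ} (hz : z ∉ K) :
    logPotential μ z = logPotential ν z := by
  obtain ⟨r, hr⟩ := hK.isBounded.subset_closedBall (0 : ℂ)
  have hμr : μ (Metric.closedBall 0 r)ᶜ = 0 := measure_mono_null (Set.compl_subset_compl.2 hr) hμ
  have hνr : ν (Metric.closedBall 0 r)ᶜ = 0 := measure_mono_null (Set.compl_subset_compl.2 hr) hν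
  set A : Set ℂ := {z | logPotential μ =ᶠ[𝓝 z] logPotential ν} with hA
  have hAopen : IsOpen A := isOpen_setOfPred_eventually_nhds
  set V : Set ℂ := Kᶜ \ A with hV
  have hVopen : IsOpen V := by
    refine isOpen_iff_mem_nhds.2 fun x hx => ?_
    obtain ⟨δ, hδ, hball⟩ := Metric.isOpen_iff.1 hK.isClosed.isOpen_compl x hx.1
    filter_upwards [Metric.ball_mem_nhds x (half_pos hδ)] with y hy
    refine ⟨hball (Metric.ball_subset_ball (by linarith) hy), fun hyA => hx.2 ?_⟩
    exact (eqOn_ball_logPotential hδ hμr hνr (measure_mono_null hball hμ)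
      (measure_mono_null hball hν) hy hyA).eventuallyEq_of_mem
      (Metric.ball_mem_nhds x (half_pos hδ))
  have hVbdd : Bornology.IsBounded V := by
    refine Metric.isBounded_closedBall (x := (0 : ℂ)) (r := R) |>.subset fun x hx => ?_
    rw [mem_closedBall_zero_iff]
    by_contra! hxR
    refine hx.2 ?_
    filter_upwards [(isOpen_lt continuous_const continuous_norm).mem_nhds hxR] with y hy
    exact h y hy
  have hVfront : frontier V ⊆ K := by
    rw [hVopen.frontier_eq]
    intro x hx
    by_contra hxK
    have hxA : x ∈ A := by
      by_contra hxA
      exact hx.2 ⟨hxK, hxA⟩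
    obtain ⟨y, hyA, hyV⟩ := mem_closure_iff.1 hx.1 A hAopen hxA
    exact hyV.2 hyA
  -- V is bounded with frontier in K, so the maximum modulus principle for polynomials puts V into
  -- the hull of K, which is K.
  have hVempty : ∀ x, x ∉ V := by
    intro x hx
    refine hx.1 ?_
    rw [← hconv]
    intro p C hC
    exact Complex.norm_le_of_forall_mem_frontier_norm_le hVbdd
      p.differentiable.diffContOnCl (fun w hw => hC w (hVfront hw)) (subset_closure hx)
  have hzA : z ∈ A := by
    by_contra hzA
    exact hVempty z ⟨hz, hzA⟩
  exact Eventually.self_of_nhds (p := fun x => logPotential μ x = logPotential ν x) hzA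

theorem exists_measure_ball_eq_zero (hK : IsClosed K) (hμ : μ Kᶜ = 0) {z : ℂ} (hz : z ∉ K) :
    ∃ δ > 0, μ (Metric.ball z δ) = 0 := by
  obtain ⟨δ, hδ, hball⟩ := Metric.isOpen_iff.1 hK.isOpen_compl z hz
  exact ⟨δ, hδ, measure_mono_null hball hμ⟩

/-- A measure on the boundary of a polynomially convex set whose logarithmic potential agrees with
that of the equilibrium measure near infinity is the equilibrium measure. -/
theorem IsMinimizer.eq_of_logPotential_eq [IsProbabilityMeasure ω] [IsProbabilityMeasure μ]
    (hr : 0 < r) (hω : IsMinimizer (10 * r) K ω) (hK : IsCompact K)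
    (hKr : K ⊆ Metric.closedBall 0 r) (hconv : PolynomiallyConvex K) (hμ : μ (frontier K)ᶜ = 0)
    (h : ∀ z : ℂ, R < ‖z‖ → logPotential μ z = logPotential ω z) : μ = ω := by
  have hM : 0 < 10 * r := by positivity
  have hμK : μ Kᶜ = 0 :=
    measure_mono_null (Set.compl_subset_compl.2 hK.isClosed.frontier_subset) hμ
  have hμr : μ (Metric.closedBall 0 r)ᶜ = 0 :=
    measure_mono_null (Set.compl_subset_compl.2 hKr) hμK
  have hωr : ω (Metric.closedBall 0 r)ᶜ = 0 :=
    measure_mono_null (Set.compl_subset_compl.2 hKr) hω.measure_compl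
  have hoff : ∀ z : ℂ, z ∉ K → ‖z‖ ≤ 3 * r →
      truncPotential (10 * r) μ z = truncPotential (10 * r) ω z := by
    intro z hz hzr
    obtain ⟨δ, hδ, hball⟩ := exists_measure_ball_eq_zero hK.isClosed hμK hz
    obtain ⟨δ', hδ', hball'⟩ := exists_measure_ball_eq_zero hK.isClosed hω.measure_compl hz
    rw [truncPotential_eq_ofReal hM hδ hball hμr (by linarith),
      truncPotential_eq_ofReal hM hδ' hball' hωr (by linarith),
      logPotential_eq_of_notMem hK hconv hμK hω.measure_compl h hz]
  have hωle := hω.truncPotential_le hr hKr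
  -- Points of J are limits of points off K, where the potential is that of ω; sublevel sets are
  -- closed.
  have hfront : ∀ z ∈ frontier K, truncPotential (10 * r) μ z ≤ truncEnergy (10 * r) ω := by
    intro z hz
    have hzball : z ∈ Metric.ball (0 : ℂ) (2 * r) :=
      Metric.closedBall_subset_ball (by linarith) (hKr (hK.isClosed.frontier_subset hz))
    have hzc : z ∈ closure Kᶜ := by
      rw [← frontier_compl] at hz
      exact frontier_subset_closure hz
    have h1 : Metric.ball (0 : ℂ) (2 * r) ∩ Kᶜ ⊆
        {z | truncPotential (10 * r) μ z ≤ truncEnergy (10 * r) ω} := by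
      rintro y ⟨hy, hyK⟩
      rw [mem_ball_zero_iff] at hy
      rw [Set.mem_ofPred_eq, hoff y hyK (by linarith)]
      exact hωle y
    exact closure_minimal h1 (isClosed_truncPotential_le _ _ _)
      (Metric.isOpen_ball.inter_closure ⟨hzball, hzc⟩)
  have hE : truncEnergy (10 * r) μ ≤ truncEnergy (10 * r) ω := by
    have hae : ∀ᵐ z ∂μ, z ∈ frontier K := hμ
    calc truncEnergy (10 * r) μ ≤ ∫⁻ _, truncEnergy (10 * r) ω ∂μ := by
          refine lintegral_mono_ae ?_
          filter_upwards [hae] with z hz using hfront z hz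
      _ = _ := by simp
  have hEeq := le_antisymm hE (hω.le μ inferInstance hμK)
  have hμmin : IsMinimizer (10 * r) K μ :=
    ⟨hμK, hE.trans_lt hω.lt_top, fun ν hν hνK => hE.trans (hω.le ν hν hνK)⟩
  have hμle := hμmin.truncPotential_le hr hKr
  refine eq_of_ae_truncPotential_eq hr (by linarith) hμr hωr hμmin.lt_top.ne hμle ?_
  -- Both measures being minimizers, both potentials equal the common energy almost everywhere on K.
  filter_upwards [hω.ae_volume_le hM hK, hμmin.ae_volume_le hM hK] with z hz1 hz2 hzr
  by_cases hzK : z ∈ K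
  · rw [le_antisymm (hμle z) (hz2 hzK), le_antisymm (hωle z) (hz1 hzK), hEeq]
  · exact hoff z hzK hzr

theorem logPotential_le [IsProbabilityMeasure μ] (hμ : μ (Metric.closedBall 0 r)ᶜ = 0) {z : ℂ}
    (hz : r < ‖z‖) : logPotential μ z ≤ Real.log (‖z‖ + r) ∧
      Real.log (‖z‖ - r) ≤ logPotential μ z := by
  have hball : ∀ᵐ w ∂μ, w ∈ Metric.closedBall (0 : ℂ) r := hμ
  have hδ : 0 < ‖z‖ - r := sub_pos.2 hz
  have hz0 : μ (Metric.ball z (‖z‖ - r)) = 0 := by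
    have hsub : Metric.ball z (‖z‖ - r) ⊆ (Metric.closedBall 0 r)ᶜ := by
      intro w hw hwr
      rw [mem_closedBall_zero_iff] at hwr
      rw [Metric.mem_ball, dist_comm, dist_eq_norm] at hw
      linarith [norm_sub_norm_le z w]
    exact measure_mono_null hsub hμ
  have hint := integrable_log_norm_sub hδ hz0 hμ
  constructor
  · calc logPotential μ z ≤ ∫ _, Real.log (‖z‖ + r) ∂μ := by
          refine integral_mono_ae hint (integrable_const _) ?_
          filter_upwards [ae_le_norm_sub hz0, hball] with w h1 h2
          rw [mem_closedBall_zero_iff] at h2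
          exact Real.log_le_log (hδ.trans_le h1) (by linarith [norm_sub_le z w])
      _ = _ := by simp
  · calc Real.log (‖z‖ - r) = ∫ _, Real.log (‖z‖ - r) ∂μ := by simp
      _ ≤ logPotential μ z := by
          refine integral_mono_ae (integrable_const _) hint ?_
          filter_upwards [ae_le_norm_sub hz0] with w h1
          exact Real.log_le_log hδ h1

/-- If two logarithmic potentials differ by a constant near infinity, then they are equal there. -/
theorem logPotential_eq_of_sub_eq [IsProbabilityMeasure μ] [IsProbabilityMeasure ν] (hr : 0 < r)
    (hμ : μ (Metric.closedBall 0 r)ᶜ = 0) (hν : ν (Metric.closedBall 0 r)ᶜ = 0)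
    (h : ∀ y z : ℂ, r < ‖y‖ → r < ‖z‖ →
      logPotential μ y - logPotential ν y = logPotential μ z - logPotential ν z) {z : ℂ}
    (hz : r < ‖z‖) : logPotential μ z = logPotential ν z := by
  -- The constant difference may be evaluated at the far real point t, where both potentials lie
  -- between log(t-r) and log(t+r).
  have hbound : ∀ t : ℝ, r < t → |logPotential μ z - logPotential ν z| ≤ 2 * r / (t - r) := by
    intro t ht
    have ht0 : 0 < t - r := sub_pos.2 ht
    have hnorm : ‖(t : ℂ)‖ = t := by
      rw [Complex.norm_real, Real.norm_eq_abs, abs_of_pos (hr.trans ht)]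
    have hr' : r < ‖(t : ℂ)‖ := by rwa [hnorm]
    have h1 := logPotential_le hμ hr'
    have h2 := logPotential_le hν hr'
    rw [hnorm] at h1 h2
    rw [h z t hz hr', abs_le]
    have h3 : Real.log (t + r) - Real.log (t - r) ≤ 2 * r / (t - r) := by
      rw [← Real.log_div (by linarith) ht0.ne']
      refine (Real.log_le_sub_one_of_pos (div_pos (by linarith) ht0)).trans (le_of_eq ?_)
      field_simp
      ring
    constructor <;> linarith
  have hlim : Tendsto (fun t : ℝ => 2 * r / (t - r)) atTop (𝓝 0) :=
    tendsto_const_nhds.div_atTop (tendsto_atTop_add_const_right _ (-r) tendsto_id)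
  have h0 := ge_of_tendsto hlim ((eventually_gt_atTop r).mono hbound)
  exact sub_eq_zero.1 (abs_nonpos_iff.1 h0)

end Identity

/-! ### Root measures and log|q|. -/

section RootMeasure

variable {q : Polynomial ℂ} {r : ℝ}

theorem multiset_sum_dirac_eq_zero {s : Multiset ℂ} {A : Set ℂ} (hA : MeasurableSet A)
    (h : ∀ z ∈ s, z ∉ A) : (s.map (fun z => (Measure.dirac z : Measure ℂ))).sum A = 0 := by
  induction s using Multiset.induction_on with
  | empty => simp
  | cons a s ih =>
    rw [Multiset.map_cons, Multiset.sum_cons, Measure.add_apply,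
      ih fun z hz => h z (Multiset.mem_cons_of_mem hz), Measure.dirac_apply' _ hA,
      Set.indicator_of_notMem (h a (Multiset.mem_cons_self a s)), add_zero]

theorem rootMeasure_eq_zero (hq : q ≠ 0) {A : Set ℂ} (hA : MeasurableSet A)
    (h : ∀ z ∈ A, q.eval z ≠ 0) : rootMeasure q A = 0 := by
  rw [rootMeasure, Measure.smul_apply, multiset_sum_dirac_eq_zero hA, smul_zero]
  exact fun z hz hzA => h z hzA ((Polynomial.mem_roots hq).1 hz)

theorem integral_multiset_sum_dirac {f : ℂ → ℝ} (s : Multiset ℂ) :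
    Integrable f (s.map (fun z => (Measure.dirac z : Measure ℂ))).sum ∧
      ∫ w, f w ∂(s.map (fun z => (Measure.dirac z : Measure ℂ))).sum = (s.map f).sum := by
  induction s using Multiset.induction_on with
  | empty => simp
  | cons a s ih =>
    have ha : Integrable f (Measure.dirac a) := integrable_dirac (by simp)
    simp only [Multiset.map_cons, Multiset.sum_cons]
    refine ⟨ha.add_measure ih.1, ?_⟩
    rw [integral_add_measure ha ih.1, ih.2, integral_dirac]

theorem integral_rootMeasure (f : ℂ → ℝ) :
    ∫ w, f w ∂(rootMeasure q) = 1 / (q.natDegree : ℝ) * (q.roots.map f).sum := by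
  rw [rootMeasure, integral_smul_measure, (integral_multiset_sum_dirac _).2]
  simp

theorem log_norm_prod_sub {s : Multiset ℂ} {z : ℂ} (h : z ∉ s) :
    Real.log ‖(s.map (fun a => z - a)).prod‖ = (s.map fun a => Real.log ‖z - a‖).sum := by
  induction s using Multiset.induction_on with
  | empty => simp
  | cons a s ih =>
    rw [Multiset.mem_cons, not_or] at h
    have h0 : (s.map (fun a => z - a)).prod ≠ 0 := by
      rw [Ne, Multiset.prod_eq_zero_iff, Multiset.mem_map]
      rintro ⟨b, hb, hzb⟩
      exact h.2 (sub_eq_zero.1 hzb ▸ hb)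
    rw [Multiset.map_cons, Multiset.prod_cons, norm_mul, Real.log_mul
      (norm_ne_zero_iff.2 (sub_ne_zero.2 h.1)) (norm_ne_zero_iff.2 h0), ih h.2,
      Multiset.map_cons, Multiset.sum_cons]

/-- Factor q over its roots: the leading coefficient contributes the only term that is not a
potential, and it does not depend on z. -/
theorem log_norm_eval_eq (hq : 0 < q.natDegree) {z : ℂ} (hz : q.eval z ≠ 0) :
    1 / (q.natDegree : ℝ) * Real.log ‖q.eval z‖ =
      1 / (q.natDegree : ℝ) * Real.log ‖q.leadingCoeff‖ + logPotential (rootMeasure q) z := by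
  have hq0 : q ≠ 0 := Polynomial.ne_zero_of_natDegree_gt hq
  have hroot : z ∉ q.roots := fun h => hz ((Polynomial.mem_roots hq0).1 h)
  have heval : q.eval z = q.leadingCoeff * (q.roots.map (fun a => z - a)).prod := by
    conv_lhs => rw [(IsAlgClosed.splits q).eq_prod_roots]
    simp [Polynomial.eval_multiset_prod]
  have hprod : (q.roots.map (fun a => z - a)).prod ≠ 0 := fun h => hz (by rw [heval, h, mul_zero])
  rw [logPotential, integral_rootMeasure, ← mul_add, ← log_norm_prod_sub hroot, heval, norm_mul,
    Real.log_mul (norm_ne_zero_iff.2 (Polynomial.leadingCoeff_ne_zero.2 hq0))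
      (norm_ne_zero_iff.2 hprod)]

end RootMeasure

/-! ### Weak limits of measures in a disc. -/

section WeakLimit

variable {r : ℝ}

theorem tendsto_logPotential {ι : Type*} {l : Filter ι} {μs : ι → ProbabilityMeasure ℂ}
    {μ : ProbabilityMeasure ℂ} (hlim : Tendsto μs l (𝓝 μ))
    (hμs : ∀ᶠ i in l, (μs i : Measure ℂ) (Metric.closedBall 0 r)ᶜ = 0)
    (hμ : (μ : Measure ℂ) (Metric.closedBall 0 r)ᶜ = 0) {z : ℂ} (hz : r < ‖z‖) (hr : 0 < r) :
    Tendsto (fun i => logPotential (μs i) z) l (𝓝 (logPotential μ z)) := by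
  have hδ : 0 < ‖z‖ - r := sub_pos.2 hz
  -- Clamping |z-w| to [|z|-r, |z|+r] gives a bounded continuous test function without changing
  -- anything for w in the disc.
  set φ : ℂ → ℝ := fun w => min (max ‖z - w‖ (‖z‖ - r)) (‖z‖ + r) with hφ
  have hφpos : ∀ w, ‖z‖ - r ≤ φ w := fun w => le_min (le_max_right _ _) (by linarith)
  have hcont : Continuous fun w => Real.log (φ w) := by
    refine Continuous.log (by fun_prop) fun w => (hδ.trans_le (hφpos w)).ne'
  set f : BoundedContinuousFunction ℂ ℝ := BoundedContinuousFunction.ofNormedAddCommGroup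
    (fun w => Real.log (φ w)) hcont (max |Real.log (‖z‖ - r)| |Real.log (‖z‖ + r)|) (fun w => by
      rw [Real.norm_eq_abs]
      exact abs_le_max_abs_abs (Real.log_le_log hδ (hφpos w))
        (Real.log_le_log (hδ.trans_le (hφpos w)) (min_le_right _ _))) with hf
  have heq : ∀ ν : Measure ℂ, ν (Metric.closedBall 0 r)ᶜ = 0 →
      ∫ w, f w ∂ν = logPotential ν z := by
    intro ν hν
    have hball : ∀ᵐ w ∂ν, w ∈ Metric.closedBall (0 : ℂ) r := hν
    refine integral_congr_ae ?_
    filter_upwards [hball] with w hw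
    rw [mem_closedBall_zero_iff] at hw
    change Real.log (φ w) = _
    rw [hφ]
    simp only
    rw [max_eq_left (by linarith [norm_sub_norm_le z w]),
      min_eq_left (by linarith [norm_sub_le z w])]
  have h1 := ProbabilityMeasure.tendsto_iff_forall_integral_tendsto.1 hlim f
  rw [heq μ hμ] at h1
  refine h1.congr' ?_
  filter_upwards [hμs] with i hi using heq _ hi

theorem measure_eq_zero_of_tendsto {ι : Type*} {l : Filter ι} [l.NeBot]
    {μs : ι → ProbabilityMeasure ℂ} {μ : ProbabilityMeasure ℂ} (hlim : Tendsto μs l (𝓝 μ))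
    {G : Set ℂ} (hG : IsOpen G) (h : Tendsto (fun i => (μs i : Measure ℂ) G) l (𝓝 0)) :
    (μ : Measure ℂ) G = 0 := by
  have h1 := ProbabilityMeasure.le_liminf_measure_open_of_tendsto hlim hG
  rw [h.liminf_eq] at h1
  exact nonpos_iff_eq_zero.1 h1

/-- Prokhorov's theorem with a single compact set and no escaping mass. -/
theorem isCompact_probabilityMeasure_closedBall (r : ℝ) :
    IsCompact {μ : ProbabilityMeasure ℂ | (μ : Measure ℂ) (Metric.closedBall 0 r)ᶜ = 0} := by
  have h := isCompact_setOfPred_probabilityMeasure_mass_eq_compl_isCompact_le (E := ℂ)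
    (u := fun _ => 0) (K := fun _ => Metric.closedBall 0 r) tendsto_const_nhds
    (fun _ => isCompact_closedBall _ _) (Or.inl inferInstance)
  convert h using 2 with μ
  ext μ
  simp [ProbabilityMeasure.null_iff_toMeasure_null]

end WeakLimit

/-! ### Equilibrium measures as minimizers. -/

section Equilibrium

variable {M r : ℝ} {K : Set ℂ}

theorem energy_le_energy_iff {μ ν : Measure ℂ} [IsProbabilityMeasure μ] [IsProbabilityMeasure ν]
    (hμ : μ (Metric.closedBall 0 r)ᶜ = 0) (hν : ν (Metric.closedBall 0 r)ᶜ = 0)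
    (hM1 : 1 ≤ M) (hM : 2 * r ≤ M) : energy ν ≤ energy μ ↔ truncEnergy M μ ≤ truncEnergy M ν := by
  rw [energy_eq hμ hM1 hM, energy_eq hν hM1 hM]
  generalize truncEnergy M μ = a
  generalize truncEnergy M ν = b
  induction a with
  | top =>
    induction b with
    | top => simp
    | coe b =>
      simp [EReal.coe_nnreal_eq_coe_real, ← EReal.coe_sub]
  | coe a =>
    induction b with
    | top => simp
    | coe b =>
      simp only [EReal.coe_nnreal_eq_coe_real, ← EReal.coe_sub, EReal.coe_le_coe_iff,
        sub_le_sub_iff_left, NNReal.coe_le_coe, ENNReal.coe_le_coe]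

/-- Non-polarity enters only to make the minimum finite: a witness, once normalized, is a competitor
of finite energy. The bound 1 ≤ r ensures log(10r) ≥ 0. -/
theorem IsEquilibriumMeasure.isMinimizer {ω : ProbabilityMeasure ℂ} (h : IsEquilibriumMeasure K ω)
    (hpolar : ¬ IsPolar K) (hr : 1 ≤ r) (hKr : K ⊆ Metric.closedBall 0 r) :
    IsMinimizer (10 * r) K (ω : Measure ℂ) := by
  have hball : ∀ ν : Measure ℂ, ν Kᶜ = 0 → ν (Metric.closedBall 0 r)ᶜ = 0 := fun ν hν =>
    measure_mono_null (Set.compl_subset_compl.2 hKr) hν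
  have hle : ∀ ν : Measure ℂ, IsProbabilityMeasure ν → ν Kᶜ = 0 →
      truncEnergy (10 * r) ω ≤ truncEnergy (10 * r) ν := by
    intro ν hν hνK
    exact (energy_le_energy_iff (hball ω h.1) (hball ν hνK) (by linarith) (by linarith)).1
      (h.2 ⟨ν, hν⟩ hνK)
  refine ⟨h.1, ?_, hle⟩
  simp only [IsPolar, not_forall] at hpolar
  obtain ⟨μ, hμfin, hμ0, ⟨C, hCK, hC, hμC⟩, hμe⟩ := hpolar
  have hμK : μ Kᶜ = 0 := measure_mono_null (Set.compl_subset_compl.2 hCK) hμC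
  have hfin := truncEnergy_lt_top_of_energy_ne_bot (M := 10 * r) (hball μ hμK) (by linarith)
    (by linarith) hμe
  have hmass0 : μ Set.univ ≠ 0 := by simpa using hμ0
  have hprob : IsProbabilityMeasure ((μ Set.univ)⁻¹ • μ) :=
    ⟨by rw [Measure.smul_apply, smul_eq_mul, ENNReal.inv_mul_cancel hmass0 (measure_ne_top _ _)]⟩
  refine (hle _ hprob (by simp [hμK])).trans_lt ?_
  rw [truncEnergy_smul]
  exact ENNReal.mul_lt_top (ENNReal.pow_lt_top (ENNReal.inv_lt_top.2 (pos_iff_ne_zero.2 hmass0)))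
    hfin

theorem potential_eq_logPotential {μ : Measure ℂ} [IsFiniteMeasure μ] {δ : ℝ} {z : ℂ} (hδ : 0 < δ)
    (h : μ (Metric.ball z δ) = 0) (hμ : μ (Metric.closedBall 0 r)ᶜ = 0) :
    potential μ z = (logPotential μ z : ℝ) := by
  have hint := integrable_log_norm_sub hδ h hμ
  have hae : ∀ᵐ w ∂μ, logKernel z w = (Real.log ‖z - w‖ : ℝ) := by
    filter_upwards [ae_le_norm_sub h] with w hw
    refine logKernel_of_ne ?_
    rintro rfl
    simp at hw
    linarith
  have h1 : ∫⁻ w, (logKernel z w).toENNReal ∂μ = ∫⁻ w, ENNReal.ofReal (Real.log ‖z - w‖) ∂μ := by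
    refine lintegral_congr_ae ?_
    filter_upwards [hae] with w hw
    rw [hw, EReal.real_coe_toENNReal]
  have h2 : ∫⁻ w, (-logKernel z w).toENNReal ∂μ =
      ∫⁻ w, ENNReal.ofReal (-Real.log ‖z - w‖) ∂μ := by
    refine lintegral_congr_ae ?_
    filter_upwards [hae] with w hw
    rw [hw, ← EReal.coe_neg, EReal.real_coe_toENNReal]
  have h3 : ∫⁻ w, ENNReal.ofReal (-Real.log ‖z - w‖) ∂μ ≠ ⊤ := hint.neg.lintegral_lt_top.ne
  rw [potential, eintegral, h1, h2, logPotential,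
    integral_eq_lintegral_pos_part_sub_lintegral_neg_part hint, EReal.coe_sub,
    EReal.coe_ennreal_toReal hint.lintegral_lt_top.ne,
    EReal.coe_ennreal_toReal h3]

end Equilibrium

end KRegular

/-! ### The main theorem. -/

open KRegular

theorem mainTheorem2 (K : Set ℂ) (hK : IsCompact K) (hpolar : ¬ KRegular.IsPolar K)
    (hconv : KRegular.PolynomiallyConvex K)
    (ω : ProbabilityMeasure ℂ) (hω : KRegular.IsEquilibriumMeasure K ω)
    (q : ℕ → Polynomial ℂ) (hpos : ∀ k, 0 < (q k).natDegree)
    (hdeg : Tendsto (fun k => (q k).natDegree) atTop atTop)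
    (hreg : KRegular.IsRegular K ω q) :
    Tendsto (fun k => KRegular.rootDistribution (q k) (hpos k)) atTop (𝓝 ω) ↔
      KRegular.WeaklyCenters q (frontier K) := by
  obtain ⟨R, hR, hKR, hroots, hunif⟩ := hreg
  set r : ℝ := max 1 R with hrdef
  have hr1 : 1 ≤ r := le_max_left _ _
  have hr0 : 0 < r := by linarith
  have hRr : R ≤ r := le_max_right _ _
  have hKr : K ⊆ Metric.closedBall 0 r :=
    hKR.trans (Metric.ball_subset_closedBall.trans (Metric.closedBall_subset_closedBall hRr))
  have hmin := hω.isMinimizer hpolar hr1 hKr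
  have hωr : (ω : Measure ℂ) (Metric.closedBall 0 r)ᶜ = 0 :=
    measure_mono_null (Set.compl_subset_compl.2 hKr) hω.1
  have hq0 : ∀ k, q k ≠ 0 := fun k => Polynomial.ne_zero_of_natDegree_gt (hpos k)
  constructor
  · intro hlim
    refine ⟨?_, fun L hL hLK => ?_⟩
    · obtain ⟨N, hN⟩ := eventually_atTop.1 hroots
      refine ⟨N, R, hR, fun k hk z hz => ?_⟩
      by_contra h
      exact hN k hk z h hz
    · have hωL : (ω : Measure ℂ) L = 0 := by
        refine measure_mono_null (t := Kᶜ ∪ interior K) (fun z hz => ?_)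
          (measure_union_null hω.1
            (IsMinimizer.measure_interior (ω := (ω : Measure ℂ)) hr0 hmin hK hKr))
        by_contra h
        rw [Set.mem_union, not_or, Set.mem_compl_iff, not_not] at h
        exact Set.disjoint_left.1 hLK hz (hK.isClosed.frontier_eq ▸ h)
      have h1 := ProbabilityMeasure.limsup_measure_closed_le_of_tendsto hlim hL
      rw [hωL] at h1
      exact tendsto_of_le_liminf_of_limsup_le (zero_le) h1
  · rintro ⟨-, hcenter⟩
    -- Ultrafilters play the part of subsequences: each has a limit by compactness, and it suffices
    -- that this limit is ω.
    rw [tendsto_iff_ultrafilter]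
    intro g hg
    set μs : ℕ → ProbabilityMeasure ℂ := fun k => rootDistribution (q k) (hpos k) with hμs
    have hevball : ∀ᶠ k in (g : Filter ℕ), (μs k : Measure ℂ) (Metric.closedBall 0 r)ᶜ = 0 := by
      refine hg ?_
      filter_upwards [hroots] with k hk
      refine rootMeasure_eq_zero (hq0 k) Metric.isClosed_closedBall.measurableSet.compl
        fun z hz => ?_
      refine hk z fun hz' => hz ?_
      exact (Metric.ball_subset_closedBall.trans (Metric.closedBall_subset_closedBall hRr)) hz'
    obtain ⟨μ, hμr, hμlim⟩ := (isCompact_probabilityMeasure_closedBall r).ultrafilter_le_nhds'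
      (g.map μs) hevball
    have hlim : Tendsto μs g (𝓝 μ) := hμlim
    have hμfront : (μ : Measure ℂ) (frontier K)ᶜ = 0 := by
      refine measure_null_of_locally_null _ fun a ha => ?_
      obtain ⟨δ, hδ, hball⟩ := Metric.isOpen_iff.1 isClosed_frontier.isOpen_compl a ha
      refine ⟨Metric.ball a (δ / 2),
        mem_nhdsWithin_of_mem_nhds (Metric.ball_mem_nhds a (half_pos hδ)), ?_⟩
      have h1 : Tendsto (fun k => (μs k : Measure ℂ) (Metric.closedBall a (δ / 2))) g (𝓝 0) := by
        refine (hcenter _ Metric.isClosed_closedBall ?_).mono_left hg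
        refine Set.disjoint_left.2 fun z hz => ?_
        exact hball (Metric.closedBall_subset_ball (half_lt_self hδ) hz)
      refine measure_eq_zero_of_tendsto hlim Metric.isOpen_ball ?_
      exact tendsto_of_tendsto_of_tendsto_of_le_of_le tendsto_const_nhds h1 (fun _ => zero_le)
        fun k => measure_mono Metric.ball_subset_closedBall
    -- The sequence does not involve z, so uniqueness of limits makes the difference of the two
    -- potentials constant outside the disc.
    have hlog : ∀ z : ℂ, r < ‖z‖ → Tendsto (fun k => 1 / ((q k).natDegree : ℝ) *
        Real.log ‖(q k).leadingCoeff‖) g (𝓝 (logPotential ω z - logPotential μ z -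
          (energy (ω : Measure ℂ)).toReal)) := by
      intro z hz
      have hzR : z ∈ (Metric.ball (0 : ℂ) R)ᶜ := by
        rw [Set.mem_compl_iff, mem_ball_zero_iff]
        linarith
      have hzK : z ∉ K := fun h => hzR (hKR h)
      obtain ⟨δ, hδ, hball⟩ := exists_measure_ball_eq_zero hK.isClosed hω.1 hzK
      have h1 := (hunif.tendsto_at hzR).mono_left hg
      rw [greenFunction, potential_eq_logPotential hδ hball hωr, EReal.toReal_coe] at h1
      have h2 := h1.sub (tendsto_logPotential hlim hevball hμr hz hr0)
      rw [sub_right_comm] at h2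
      refine h2.congr' ?_
      filter_upwards [hg hroots] with k hk
      rw [log_norm_eval_eq (hpos k) (hk z hzR)]
      exact add_sub_cancel_right _ _
    have hpot : ∀ z : ℂ, r < ‖z‖ → logPotential μ z = logPotential ω z := by
      intro z hz
      refine logPotential_eq_of_sub_eq hr0 hμr hωr (fun y z hy hz => ?_) hz
      linarith [tendsto_nhds_unique (hlog y hy) (hlog z hz)]
    have hμω : μ = ω := Subtype.ext
      (IsMinimizer.eq_of_logPotential_eq (ω := (ω : Measure ℂ)) (μ := (μ : Measure ℂ))
        hr0 hmin hK hKr hconv hμfront hpot)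
    rwa [hμω] at hlim
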